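/- Let $X$ and $Y$ be finite topological spaces and let $f\colon X\to Y$ be a continuous map. For a point $p$ of a finite space let $C_p$ be its closure and $U_p$ the smallest open set containing $p$; write $p\le q$ if $C_p\subseteq C_q$. An abelian data $F$ on $X$ is a functor from the preordered set $(X,\le)$ to abelian groups: an abelian group $F_p$ for each $p\in X$ and homomorphisms $F_p\to F_q$ for $p\le q$, compatible with identities and composition. For a subspace $S\subseteq X$ let $F_{|S}$ be the restriction of $F$ to $S$ and $\Gamma(S,F)=\varprojlim_{s\in S}F_s$. Let $H^i(X,-)$ be the right derived functors of $\Gamma(X,-)$, let $f_*F$ be the abelian data on $Y$ with $(f_*F)_y=\Gamma(f^{-1}(U_y),F)$, and let $R^if_*$ be the right derived functors of $f_*$. A finite space $Z$ is called homologically trivial if, for every abelian group $G$ (regarded as constant abelian data on $Z$), the canonical map $G\to H^0(Z,G)$ is an isomorphism and $H^i(Z,G)=0$ for all $i>0$. The following conditions are equivalent: 1. $f$ is cohomologically proper, that is: $f$ is closed and, for every $x\in X$ and every $y\in C_{f(x)}$, the fiber over $y$ of the induced map $f_{|C_x}\colon C_x\to C_{f(x)}$ is homologically trivial. 2. For every abelian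 data $F$ on $X$, every $y\in Y$ and every $i\ge 0$, the base change morphism $$(R^if_*F)_y\to H^i\bigl(f^{-1}(y),F_{|f^{-1}(y)}\bigr),$$ induced by the restriction maps $\Gamma(f^{-1}(U_y),-)\to\Gamma(f^{-1}(y),-)$, is an isomorphism. -/

import Mathlib

open CategoryTheory Limits

universe u

noncomputable section

namespace FiniteSpace

/-! ### Comparison of right derived functors along exact functors -/

section Comparison

variable {A A' B D : Type*} [Category* A] [Category* A'] [Category* B] [Category* D]
  [Abelian A] [Abelian A'] [Abelian B] [Abelian D]

/-- Let `r` be an exact functor, `I` an injective resolution of `F` and `J` an injective resolution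
of `r F`. The identity of `r F` extends to a morphism of complexes `r I ⟶ J`
(and the extension is unique up to homotopy). -/
theorem exists_comparison (r : A ⥤ A') [r.Additive] [r.PreservesHomology] {F : A}
    (I : InjectiveResolution F) (J : InjectiveResolution (r.obj F)) :
    ∃ φ : (r.mapHomologicalComplex (ComplexShape.up ℕ)).obj I.cocomplex ⟶ J.cocomplex,
      r.map (I.ι.f 0) ≫ φ.f 0 = J.ι.f 0 := by
  have e0 := I.exact₀.map r
  have es := fun n => (I.exact_succ n).map r
  let ι : F ⟶ I.cocomplex.X 0 := I.ι.f 0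
  have : Mono ι := inferInstanceAs (Mono (I.ι.f 0))
  have : PreservesFiniteLimits r := r.preservesFiniteLimits_of_preservesHomology
  have : Mono (r.map ι) := r.map_mono ι
  let f0 : r.obj (I.cocomplex.X 0) ⟶ J.cocomplex.X 0 :=
    Injective.factorThru (X := r.obj F) (J.ι.f 0) (r.map ι)
  have h0 : r.map ι ≫ f0 = J.ι.f 0 := Injective.comp_factorThru (X := r.obj F) (J.ι.f 0) (r.map ι)
  have w0 : r.map ι ≫ f0 ≫ J.cocomplex.d 0 1 = 0 := by
    rw [← Category.assoc, h0]
    exact J.ι_f_zero_comp_complex_d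
  let f1 : r.obj (I.cocomplex.X 1) ⟶ J.cocomplex.X 1 :=
    e0.descToInjective (f0 ≫ J.cocomplex.d 0 1) w0
  have h1 : r.map (I.cocomplex.d 0 1) ≫ f1 = f0 ≫ J.cocomplex.d 0 1 :=
    e0.comp_descToInjective _ w0
  have step : ∀ (n : ℕ) (g : r.obj (I.cocomplex.X n) ⟶ J.cocomplex.X n)
      (g' : r.obj (I.cocomplex.X (n + 1)) ⟶ J.cocomplex.X (n + 1)),
      g ≫ J.cocomplex.d n (n + 1) = r.map (I.cocomplex.d n (n + 1)) ≫ g' →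
      r.map (I.cocomplex.d n (n + 1)) ≫ g' ≫ J.cocomplex.d (n + 1) (n + 2) = 0 := by
    intro n g g' w
    rw [← reassoc_of% w]
    simp
  refine ⟨CochainComplex.mkHom _ _ f0 f1 h1.symm fun n ⟨g, g', w⟩ =>
    ⟨(es n).descToInjective (g' ≫ J.cocomplex.d (n + 1) (n + 2)) (step n g g' w),
      ((es n).comp_descToInjective _ (step n g g' w)).symm⟩, ?_⟩
  exact h0

/-- A chosen extension `r I ⟶ J` of the identity of `r F`. -/
def comparison (r : A ⥤ A') [r.Additive] [r.PreservesHomology] {F : A}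
    (I : InjectiveResolution F) (J : InjectiveResolution (r.obj F)) :
    (r.mapHomologicalComplex (ComplexShape.up ℕ)).obj I.cocomplex ⟶ J.cocomplex :=
  (exists_comparison r I J).choose

theorem comparison_comm (r : A ⥤ A') [r.Additive] [r.PreservesHomology] {F : A}
    (I : InjectiveResolution F) (J : InjectiveResolution (r.obj F)) :
    r.map (I.ι.f 0) ≫ (comparison r I J).f 0 = J.ι.f 0 :=
  (exists_comparison r I J).choose_spec

/-- Given additive functors `G : A ⥤ B` and `H : A' ⥤ D`, exact functors `E : B ⥤ D` and
`r : A ⥤ A'`, and a natural transformation `θ : E ∘ G ⟶ H ∘ r`, this is the induced morphism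
`E (Rⁱ G F) ⟶ Rⁱ H (r F)`. For injective resolutions `F ⟶ I` and `r F ⟶ J` it is
`E (Hⁱ (G I)) ≅ Hⁱ (E G I) ⟶ Hⁱ (H r I) ⟶ Hⁱ (H J)`, where the last two morphisms come from
`θ` and from an extension `r I ⟶ J` of the identity of `r F`. -/
def derivedComparison [HasInjectiveResolutions A] [HasInjectiveResolutions A']
    (G : A ⥤ B) [G.Additive] (E : B ⥤ D) [E.Additive] [E.PreservesHomology]
    (r : A ⥤ A') [r.Additive] [r.PreservesHomology] (H : A' ⥤ D) [H.Additive]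
    (θ : G ⋙ E ⟶ r ⋙ H) (i : ℕ) (F : A) :
    E.obj ((G.rightDerived i).obj F) ⟶ (H.rightDerived i).obj (r.obj F) :=
  let I := injectiveResolution F
  let J := injectiveResolution (r.obj F)
  E.map (I.isoRightDerivedObj G i).hom ≫
    ((((G.mapHomologicalComplex (ComplexShape.up ℕ)).obj I.cocomplex).sc i).mapHomologyIso E).inv ≫
      HomologicalComplex.homologyMap
        ((NatTrans.mapHomologicalComplex θ (ComplexShape.up ℕ)).app I.cocomplex ≫
          (H.mapHomologicalComplex (ComplexShape.up ℕ)).map (comparison r I J)) i ≫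
        (J.isoRightDerivedObj H i).inv

end Comparison

/-! ### Abelian data, sections, cohomology -/

/-- Abelian data on `X`: functors from `X`, with the preorder
`p ≤ q ↔ closure {p} ⊆ closure {q}`, to abelian groups. -/
abbrev AbData (X : Type u) [TopologicalSpace X] : Type (u + 1) :=
  Specialization X ⥤ AddCommGrpCat.{u}

section

variable {X Y : Type u} [TopologicalSpace X] [TopologicalSpace Y]

theorem le_iff_closure_subset (p q : X) :
    Specialization.toEquiv p ≤ Specialization.toEquiv q ↔ closure {p} ⊆ closure {q} := by
  rw [Specialization.toEquiv_le_toEquiv, specializes_iff_closure_subset]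

instance : EnoughInjectives (AbData X) := by
  have e : Sheaf (⊥ : GrothendieckTopology (Specialization X)ᵒᵖ) AddCommGrpCat.{u} ≌ AbData X :=
    (sheafBotEquivalence _).trans ((opOpEquivalence _).congrLeft)
  have : IsGrothendieckAbelian.{u} (AbData X) := IsGrothendieckAbelian.of_equivalence e
  infer_instance

/-- The inverse image `f⁻¹F` of abelian data. -/
def inverseImage (f : C(X, Y)) : AbData Y ⥤ AbData X :=
  (Functor.whiskeringLeft _ _ _).obj (Specialization.map f).monotone.functor

instance (f : C(X, Y)) : (inverseImage f).Additive where
  map_add := rfl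

instance (f : C(X, Y)) : PreservesFiniteLimits (inverseImage f) := by
  unfold inverseImage
  exact ⟨fun _ => inferInstance⟩

instance (f : C(X, Y)) : PreservesFiniteColimits (inverseImage f) := by
  unfold inverseImage
  exact ⟨fun _ => inferInstance⟩

/-- The inclusion of a subspace. -/
def incl (S : Set X) : C(S, X) := ⟨Subtype.val, continuous_subtype_val⟩

/-- The restriction `F ↦ F|_S` to a subspace. -/
abbrev restrict (S : Set X) : AbData X ⥤ AbData S := inverseImage (incl S)

variable (X) in
/-- The global sections `Γ(X, F) = lim_{x ∈ X} F_x`. -/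
abbrev globalSections : AbData X ⥤ AddCommGrpCat.{u} := lim

instance : (globalSections X).Additive :=
  have : (Functor.const (Specialization X) : AddCommGrpCat.{u} ⥤ AbData X).Additive :=
    { map_add := rfl }
  (constLimAdj (J := Specialization X) (C := AddCommGrpCat.{u})).right_adjoint_additive

/-- The sections `Γ(S, F) = lim_{s ∈ S} F_s` on a subspace `S` of `X`. -/
abbrev sections (S : Set X) : AbData X ⥤ AddCommGrpCat.{u} := restrict S ⋙ globalSections S

/-- The projection `Γ(S, F) ⟶ F_s`, for `s ∈ S`. -/
def sectionsπ (S : Set X) (F : AbData X) (s : S) :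
    (sections S).obj F ⟶ F.obj (Specialization.toEquiv s.1) :=
  limit.π ((restrict S).obj F) (Specialization.toEquiv s)

/-- The restriction morphism `Γ(T, F) ⟶ Γ(S, F)`, for `S ⊆ T`. -/
def sectionsRes {S T : Set X} (h : S ⊆ T) : sections (X := X) T ⟶ sections S where
  app F := limit.lift ((restrict S).obj F)
    { pt := (sections T).obj F
      π :=
        { app := fun s => sectionsπ T F (Set.inclusion h (Specialization.ofEquiv s))
          naturality := fun s t hst => by
            have : Specialization.toEquiv (Set.inclusion h (Specialization.ofEquiv s)) ≤
                Specialization.toEquiv (Set.inclusion h (Specialization.ofEquiv t)) :=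
              (continuous_inclusion h).specialization_monotone hst.le
            exact (Category.id_comp _).trans
              (limit.w ((restrict T).obj F) (homOfLE this)).symm } }
  naturality F G φ := by
    refine limit.hom_ext fun s => ?_
    simp only [sectionsπ, Functor.comp_map, lim_map, Category.assoc, limit.lift_π, limMap_π,
      limit.lift_π_assoc]
    exact limMap_π _ _

@[simp]
theorem sectionsRes_π {S T : Set X} (h : S ⊆ T) (F : AbData X) (s : S) :
    (sectionsRes h).app F ≫ sectionsπ S F s = sectionsπ T F (Set.inclusion h s) :=
  limit.lift_π _ _

@[simp]
theorem sections_map_π (S : Set X) {F G : AbData X} (φ : F ⟶ G) (s : S) :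
    (sections S).map φ ≫ sectionsπ S G s = sectionsπ S F s ≫ φ.app _ :=
  limMap_π _ _

theorem sections_hom_ext {S : Set X} {F : AbData X} {A : AddCommGrpCat.{u}}
    {a b : A ⟶ (sections S).obj F} (h : ∀ s, a ≫ sectionsπ S F s = b ≫ sectionsπ S F s) : a = b :=
  limit.hom_ext fun s => h (Specialization.ofEquiv s)

theorem sections_natTrans_ext {G : AbData X ⥤ AddCommGrpCat.{u}} {S : Set X}
    {a b : G ⟶ sections S} (h : ∀ F s, a.app F ≫ sectionsπ S F s = b.app F ≫ sectionsπ S F s) :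
    a = b :=
  NatTrans.ext (funext fun F => sections_hom_ext (h F))

/-- `f⁻¹(U_y)`, where `U_y = nhdsKer {y}` is the intersection of all the open subsets
containing `y`, i.e. the smallest one when `Y` is finite. -/
def preimageU (f : C(X, Y)) (y : Y) : Set X := f ⁻¹' nhdsKer {y}

theorem preimageU_subset (f : C(X, Y)) {y z : Specialization Y} (h : y ≤ z) :
    preimageU f (Specialization.ofEquiv z) ⊆ preimageU f (Specialization.ofEquiv y) := by
  have h' : Specialization.ofEquiv z ⤳ Specialization.ofEquiv y := h
  intro x hx
  simp only [preimageU, Set.mem_preimage, mem_nhdsKer_singleton] at hx ⊢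
  exact hx.trans h'

theorem fiber_subset_preimageU (f : C(X, Y)) (y : Y) : f ⁻¹' {y} ⊆ preimageU f y :=
  Set.preimage_mono subset_nhdsKer

/-- The direct image `f_* F`, with `(f_* F)_y = Γ(f⁻¹(U_y), F)`. -/
def directImage (f : C(X, Y)) : AbData X ⥤ AbData Y where
  obj F :=
    { obj := fun y => (sections (preimageU f (Specialization.ofEquiv y))).obj F
      map := fun g => (sectionsRes (preimageU_subset f g.le)).app F
      map_id := fun y => sections_hom_ext fun s => by simp
      map_comp := fun g h => sections_hom_ext fun s => by simp }
  map φ :=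
    { app := fun y => (sections (preimageU f (Specialization.ofEquiv y))).map φ
      naturality := fun y z g => ((sectionsRes (preimageU_subset f g.le)).naturality φ).symm }
  map_id F := by
    ext y : 2
    exact (sections _).map_id F
  map_comp φ ψ := by
    ext y : 2
    exact (sections _).map_comp φ ψ

instance (f : C(X, Y)) : (directImage f).Additive where
  map_add := by
    intro F G φ ψ
    ext y : 2
    exact (sections _).map_add

/-- The functor `F ↦ F_y`. -/
abbrev stalk (y : Y) : AbData Y ⥤ AddCommGrpCat.{u} :=
  (evaluation _ _).obj (Specialization.toEquiv y)

variable (X) in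
/-- Cohomology `Hⁱ(X, -)`, the right derived functors of `Γ(X, -)`. -/
abbrev cohomology (i : ℕ) : AbData X ⥤ AddCommGrpCat.{u} := (globalSections X).rightDerived i

/-- The higher direct images `Rⁱ f_*`, the right derived functors of `f_*`. -/
abbrev higherDirectImage (f : C(X, Y)) (i : ℕ) : AbData X ⥤ AbData Y :=
  (directImage f).rightDerived i

/-- The restriction `(f_* F)_y = Γ(f⁻¹(U_y), F) ⟶ Γ(f⁻¹(y), F|_{f⁻¹(y)})`. -/
def sectionsBaseChange (f : C(X, Y)) (y : Y) :
    directImage f ⋙ stalk y ⟶ restrict (f ⁻¹' {y}) ⋙ globalSections (f ⁻¹' {y}) where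
  app F := (sectionsRes (fiber_subset_preimageU f y)).app F
  naturality _ _ φ := (sectionsRes (fiber_subset_preimageU f y)).naturality φ

/-- The base change morphism `(Rⁱ f_* F)_y ⟶ Hⁱ(f⁻¹(y), F|_{f⁻¹(y)})`. -/
def baseChange (f : C(X, Y)) (y : Y) (i : ℕ) (F : AbData X) :
    (stalk y).obj ((higherDirectImage f i).obj F) ⟶
      (cohomology (f ⁻¹' {y}) i).obj ((restrict (f ⁻¹' {y})).obj F) :=
  derivedComparison (directImage f) (stalk y) (restrict (f ⁻¹' {y}))
    (globalSections (f ⁻¹' {y})) (sectionsBaseChange f y) i F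

/-! ### Homologically trivial spaces and cohomologically proper maps -/

variable (X) in
/-- The constant abelian data `G` on `X`. -/
abbrev constData : AddCommGrpCat.{u} ⥤ AbData X := Functor.const (Specialization X)

variable (X) in
/-- The canonical morphism `G ⟶ Γ(X, G) ⟶ H⁰(X, G)`. -/
def toCohomologyZero (G : AddCommGrpCat.{u}) : G ⟶ (cohomology X 0).obj ((constData X).obj G) :=
  constLimAdj.unit.app G ≫ (globalSections X).toRightDerivedZero.app ((constData X).obj G)

variable (X) in
/-- `X` is homologically trivial: `H⁰(X, G) = G` and `Hⁱ(X, G) = 0` for `i > 0`, for any abelian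
group `G`. -/
def IsHomologicallyTrivial : Prop :=
  ∀ G : AddCommGrpCat.{u}, IsIso (toCohomologyZero X G) ∧
    ∀ i : ℕ, 0 < i → IsZero ((cohomology X i).obj ((constData X).obj G))

/-- The map `C_x ⟶ C_{f(x)}` induced by `f` on the closures of `x` and of `f(x)`. -/
def restrictClosure (f : C(X, Y)) (x : X) :
    C((closure {x} : Set X), (closure {f x} : Set Y)) where
  toFun := Set.MapsTo.restrict f (closure {x}) (closure {f x}) (by
    simpa using (Set.mapsTo_singleton.2 rfl : Set.MapsTo f {x} {f x}).closure f.continuous)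
  continuous_toFun := f.continuous.restrict _

/-- `f` is cohomologically proper: `f` is closed and, for any `x`, the fibers of `C_x ⟶ C_{f(x)}`
are homologically trivial. -/
def IsCProper (f : C(X, Y)) : Prop :=
  IsClosedMap f ∧ ∀ (x : X) (y : (closure {f x} : Set Y)),
    IsHomologicallyTrivial (restrictClosure f x ⁻¹' {y})

end

end FiniteSpace

end

/-! The test objects are the skyscrapers `i_x M`: the value is `M` on `C_x` and zero elsewhere. The
functor `i_x` is right adjoint to the stalk at `x`, is exact and preserves injectives.

If `y ∈ C_{f(x)}`, then `x ∈ f⁻¹(U_y)`, so `Γ(f⁻¹(U_y), i_x M) = M`, and `(Rⁱf_* i_x M)_y` is `M`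
for `i = 0` and zero for `i > 0`. On the other side, `i_x M` restricted to `f⁻¹(y)` is constant data
on the fiber of `C_x ⟶ C_{f(x)}` extended by zero, and this extension is exact and preserves
injectives; so its cohomology is that of the fiber with coefficients in `M`. If `y ∉ C_{f(x)}`, both
sides vanish. Thus base change for all skyscrapers amounts to homological triviality of all these
fibers (`isHomologicallyTrivial_of_isIso_baseChange`). Trivial fibers are nonempty, so `f(C_x) =
C_{f(x)}`, and `f` is closed because `X` is finite.

Conversely, since `X` is finite, every injective object is a direct summand of a finite sum of
skyscrapers (`exists_sum_toSkyscraper_comp_eq_id`). If the fibers are trivial, then on an injective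
object the degree zero restriction `Γ(f⁻¹(U_y), -) ⟶ Γ(f⁻¹(y), -)` is an isomorphism and the
restriction to `f⁻¹(y)` is acyclic. An injective resolution of `F` therefore restricts to an acyclic
resolution on the fiber, which computes its cohomology (`isIso_derivedComparison`).

Acyclicity is expressed by Ext: `Γ` is right adjoint to the constant data functor, hence is `Hom(ℤ,
-)` for the constant data `ℤ`. Two acyclic resolutions are compared by applying `Γ` to the mapping
cone, an exact bounded below complex of acyclic objects (`isIso_homologyMap_of_extAcyclic`). -/

noncomputable section

namespace FiniteSpace

/-! ### Acyclic objects and exact sequences -/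

section ExtAcyclic

universe w

open Abelian

variable {A : Type*} [Category* A] [Abelian A]

/-- The complex `ker f ⟶ X ⟶ ker g` attached to `f : X ⟶ Y` and `g : Y ⟶ Z` with `f ≫ g = 0`. -/
abbrev kernelComplex {X Y Z : A} (f : X ⟶ Y) (g : Y ⟶ Z) (w : f ≫ g = 0) : ShortComplex A :=
  ShortComplex.mk (kernel.ι f) (kernel.lift g f w) (by ext; simp)

theorem kernelComplex_shortExact {X Y Z : A} {f : X ⟶ Y} {g : Y ⟶ Z} {w : f ≫ g = 0}
    (h : (ShortComplex.mk f g w).Exact) : (kernelComplex f g w).ShortExact where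
  exact := by
    rw [ShortComplex.exact_iff_exact_up_to_refinements]
    intro T x hx
    have hx' : x ≫ f = 0 := by simpa using hx =≫ kernel.ι g
    exact ⟨T, 𝟙 T, inferInstance, kernel.lift f x hx', by simp⟩
  mono_f := inferInstanceAs (Mono (kernel.ι f))
  epi_g := h.epi_kernelLift

/-- `Extⁱ(K, B) = 0` for `i > 0`. -/
def ExtAcyclic [HasExt.{w} A] (K B : A) : Prop := ∀ i : ℕ, Subsingleton (Ext K B (i + 1))

section

variable [HasExt.{w} A] {K : A}

theorem exists_lift_of_subsingleton_ext {S : ShortComplex A} (hS : S.ShortExact)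
    [Subsingleton (Ext K S.X₁ 1)] (c : K ⟶ S.X₃) : ∃ b : K ⟶ S.X₂, b ≫ S.g = c := by
  obtain ⟨x, hx⟩ := Ext.covariant_sequence_exact₃ K hS (Ext.mk₀ c) (zero_add 1)
    (Subsingleton.elim _ _)
  obtain ⟨b, rfl⟩ := Ext.addEquiv₀.symm.surjective x
  refine ⟨b, Ext.addEquiv₀.symm.injective ?_⟩
  simpa using hx

theorem ExtAcyclic.of_shortExact {S : ShortComplex A} (hS : S.ShortExact)
    (h₁ : ExtAcyclic K S.X₁) (h₂ : ExtAcyclic K S.X₂) : ExtAcyclic K S.X₃ := fun i => by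
  have := h₁ (i + 1)
  have := h₂ i
  refine subsingleton_of_forall_eq 0 fun x => ?_
  obtain ⟨y, rfl⟩ := Ext.covariant_sequence_exact₃ K hS x rfl (Subsingleton.elim _ _)
  rw [Subsingleton.elim y 0, Ext.zero_comp]

theorem subsingleton_ext_succ_of_shortExact {S : ShortComplex A} (hS : S.ShortExact) {i : ℕ}
    [Subsingleton (Ext K S.X₃ i)] [Subsingleton (Ext K S.X₂ (i + 1))] :
    Subsingleton (Ext K S.X₁ (i + 1)) := by
  refine subsingleton_of_forall_eq 0 fun x => ?_
  obtain ⟨y, rfl⟩ := Ext.covariant_sequence_exact₁ K hS x (Subsingleton.elim _ _) rfl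
  rw [Subsingleton.elim y 0, Ext.zero_comp]

/-- As `Ext¹(K, X₂) = 0`, every class in `Ext¹(K, X₁)` is the connecting image of some `c : K ⟶ X₃`,
and this image vanishes once `c` lifts to `X₂`. -/
theorem subsingleton_ext_one_of_shortExact {S : ShortComplex A} (hS : S.ShortExact)
    (h : ∀ c : K ⟶ S.X₃, ∃ b : K ⟶ S.X₂, b ≫ S.g = c) [Subsingleton (Ext K S.X₂ 1)] :
    Subsingleton (Ext K S.X₁ 1) := by
  refine subsingleton_of_forall_eq 0 fun x => ?_
  obtain ⟨y, rfl⟩ := Ext.covariant_sequence_exact₁ K hS x (Subsingleton.elim _ _) (zero_add 1)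
  obtain ⟨c, rfl⟩ := Ext.addEquiv₀.symm.surjective y
  obtain ⟨b, rfl⟩ := h c
  simp only [Ext.addEquiv₀_symm_apply]
  rw [← Ext.mk₀_comp_mk₀, Ext.comp_assoc_of_second_deg_zero, hS.comp_extClass, Ext.comp_zero]

theorem ExtAcyclic.of_iso {B C : A} (e : B ≅ C) (h : ExtAcyclic K B) : ExtAcyclic K C := fun i => by
  have := h i
  refine subsingleton_of_forall_eq 0 fun x => ?_
  have : (x.comp (Ext.mk₀ e.inv) (add_zero _)).comp (Ext.mk₀ e.hom) (add_zero _) = x := by simp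
  rw [← this, Subsingleton.elim (x.comp _ _) 0, Ext.zero_comp]

/-- An object whose identity is a sum of morphisms which factor through acyclic objects is
acyclic. -/
theorem ExtAcyclic.of_sum_comp_eq_id {ι : Type*} [Fintype ι] {B : A} {C : ι → A}
    (a : ∀ x, B ⟶ C x) (b : ∀ x, C x ⟶ B) (hab : ∑ x, a x ≫ b x = 𝟙 B)
    (h : ∀ x, ExtAcyclic K (C x)) : ExtAcyclic K B := fun i => by
  refine subsingleton_of_forall_eq 0 fun e => ?_
  rw [← Ext.comp_mk₀_id e, ← hab, Ext.mk₀_sum, Ext.comp_sum]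
  refine Finset.sum_eq_zero fun x _ => ?_
  have := h x i
  rw [← Ext.mk₀_comp_mk₀, ← Ext.comp_assoc_of_third_deg_zero,
    Subsingleton.elim (e.comp (Ext.mk₀ (a x)) _) 0, Ext.zero_comp]

variable {X : ℕ → A} {d : ∀ n, X n ⟶ X (n + 1)} {w : ∀ n, d n ≫ d (n + 1) = 0}

/-- Acyclicity propagates upwards through the short exact sequences `ker dₙ ⟶ Xₙ ⟶ ker dₙ₊₁`. -/
theorem extAcyclic_kernel (ex : ∀ n, (ShortComplex.mk (d n) (d (n + 1)) (w n)).Exact)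
    (hX : ∀ n, ExtAcyclic K (X n)) (h₀ : ExtAcyclic K (kernel (d 0))) :
    ∀ n, ExtAcyclic K (kernel (d n))
  | 0 => h₀
  | n + 1 => (extAcyclic_kernel ex hX h₀ n).of_shortExact (kernelComplex_shortExact (ex n)) (hX n)

/-- Dimension shifting: liftings kill `Ext¹(K, ker dₙ)`, and `Extⁱ⁺²(K, ker dₙ)` is a quotient of
`Extⁱ⁺¹(K, ker dₙ₊₁)`. The induction on `i` must therefore treat all `n` at once. -/
theorem extAcyclic_kernel_of_lift (ex : ∀ n, (ShortComplex.mk (d n) (d (n + 1)) (w n)).Exact)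
    (hX : ∀ n, ExtAcyclic K (X n))
    (h : ∀ n (c : K ⟶ X (n + 1)), c ≫ d (n + 1) = 0 → ∃ b, b ≫ d n = c) (n : ℕ) :
    ExtAcyclic K (kernel (d n)) := fun i => by
  induction i generalizing n with
  | zero =>
    have : Subsingleton (Ext K (kernelComplex _ _ (w n)).X₂ 1) := hX n 0
    refine subsingleton_ext_one_of_shortExact (kernelComplex_shortExact (ex n)) fun c => ?_
    obtain ⟨b, hb⟩ := h n (c ≫ kernel.ι _) (by simp)
    refine ⟨b, ?_⟩
    rw [← cancel_mono (kernel.ι _)]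
    simpa using hb
  | succ i ih =>
    have : Subsingleton (Ext K (kernelComplex _ _ (w n)).X₃ (i + 1)) := ih (n + 1)
    have : Subsingleton (Ext K (kernelComplex _ _ (w n)).X₂ (i + 1 + 1)) := hX n (i + 1)
    exact subsingleton_ext_succ_of_shortExact (kernelComplex_shortExact (ex n))

end

/-! ### Acyclicity for a right adjoint with values in abelian groups -/

section Adjunction

variable {H : A ⥤ AddCommGrpCat.{u}} {L : AddCommGrpCat.{u} ⥤ A} (adj : L ⊣ H)

/-- The object `L(ℤ)` representing `H`, for `L` left adjoint to `H`. -/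
abbrev corepresenting (L : AddCommGrpCat.{u} ⥤ A) : A :=
  L.obj (AddCommGrpCat.of (ULift.{u} ℤ))

omit [Abelian A] in
include adj in
theorem exists_eq_homEquiv_apply {B : A} (b : H.obj B) :
    ∃ c : corepresenting L ⟶ B, (adj.homEquiv _ _ c) ⟨1⟩ = b :=
  ⟨(adj.homEquiv _ _).symm (AddCommGrpCat.ofHom (uliftZMultiplesHom _ b)), by
    simp only [Equiv.apply_symm_apply]
    exact one_smul ℤ b⟩

theorem hom_eq_of_apply_one {G : AddCommGrpCat.{u}} {a b : AddCommGrpCat.of (ULift.{u} ℤ) ⟶ G}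
    (h : a ⟨1⟩ = b ⟨1⟩) : a = b :=
  AddCommGrpCat.hom_ext ((uliftZMultiplesHom G).symm.injective h)

variable [HasExt.{w} A] [H.Additive]

-- A cycle of `H Xₙ₊₁` is a morphism from `L(ℤ)` to `ker dₙ₊₁`; it lifts to `Xₙ` because `Ext¹(L(ℤ),
-- ker dₙ) = 0`.
include adj in
theorem map_exact_of_extAcyclic {X : ℕ → A} {d : ∀ n, X n ⟶ X (n + 1)}
    {w : ∀ n, d n ≫ d (n + 1) = 0}
    (ex : ∀ n, (ShortComplex.mk (d n) (d (n + 1)) (w n)).Exact)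
    (hX : ∀ n, ExtAcyclic (corepresenting L) (X n))
    (h₀ : ExtAcyclic (corepresenting L) (kernel (d 0))) (n : ℕ) :
    ((ShortComplex.mk (d n) (d (n + 1)) (w n)).map H).Exact := by
  rw [ShortComplex.ab_exact_iff]
  intro (y : H.obj (X (n + 1))) (hy : H.map (d (n + 1)) y = 0)
  obtain ⟨c, rfl⟩ := exists_eq_homEquiv_apply adj y
  have hc : c ≫ d (n + 1) = 0 := by
    refine (adj.homEquiv _ _).injective (hom_eq_of_apply_one ?_)
    rw [adj.homEquiv_naturality_right, AddCommGrpCat.comp_apply, hy, adj.homEquiv_unit]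
    simp
  have : Subsingleton (Ext (corepresenting L) (kernelComplex _ _ (w n)).X₁ 1) :=
    extAcyclic_kernel ex hX h₀ n 0
  obtain ⟨b, hb⟩ := exists_lift_of_subsingleton_ext (kernelComplex_shortExact (ex n))
    (kernel.lift _ c hc)
  refine ⟨adj.homEquiv _ _ b ⟨1⟩, ?_⟩
  change H.map (d n) _ = _
  rw [← AddCommGrpCat.comp_apply, ← adj.homEquiv_naturality_right]
  congr 3
  simpa using hb =≫ kernel.ι _

include adj in
/-- An object with vanishing right derived functors of `H` is acyclic. -/
theorem extAcyclic_of_isZero_rightDerived [HasInjectiveResolutions A] {B : A}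
    (hB : ∀ i, IsZero ((H.rightDerived (i + 1)).obj B)) : ExtAcyclic (corepresenting L) B := by
  let I := injectiveResolution B
  -- `B` is the kernel of the first differential of its resolution, and the liftings required
  -- express exactness of `H I` in positive degrees.
  refine ExtAcyclic.of_iso (IsLimit.conePointUniqueUpToIso (kernelIsKernel _) I.isLimitKernelFork)
    (extAcyclic_kernel_of_lift (d := fun n => I.cocomplex.d n (n + 1)) I.exact_succ
      (fun n i => Ext.subsingleton_of_injective _ _ _) (fun n c hc => ?_) 0)
  have hI : (((H.mapHomologicalComplex _).obj I.cocomplex).ExactAt (n + 1)) := by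
    rw [HomologicalComplex.exactAt_iff_isZero_homology]
    exact (hB n).of_iso (I.isoRightDerivedObj H (n + 1)).symm
  rw [HomologicalComplex.exactAt_iff' _ n (n + 1) (n + 2) (by simp) (by simp),
    ShortComplex.ab_exact_iff] at hI
  obtain ⟨(z : H.obj _), hz⟩ := hI (adj.homEquiv _ _ c ⟨1⟩) (by
    change H.map (I.cocomplex.d (n + 1) (n + 2)) _ = 0
    rw [← AddCommGrpCat.comp_apply, ← adj.homEquiv_naturality_right, hc, adj.homEquiv_unit]
    simp)
  obtain ⟨b, rfl⟩ := exists_eq_homEquiv_apply adj z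
  refine ⟨b, (adj.homEquiv _ _).injective (hom_eq_of_apply_one ?_)⟩
  rw [adj.homEquiv_naturality_right, AddCommGrpCat.comp_apply]
  exact hz

end Adjunction

end ExtAcyclic

/-! ### Comparison of acyclic resolutions -/

section Cone

universe w

variable {A : Type*} [Category* A] [Abelian A] {K J : CochainComplex A ℕ} (φ : K ⟶ J)

/-- The differential `(k, j) ↦ (-dk, φ k + dj)` of the mapping cone of `φ`. -/
def coneD (n : ℕ) : K.X (n + 1) ⊞ J.X n ⟶ K.X (n + 2) ⊞ J.X (n + 1) :=
  biprod.desc (biprod.lift (-K.d (n + 1) (n + 2)) (φ.f (n + 1))) (J.d n (n + 1) ≫ biprod.inr)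

/-- The first differential `k ↦ (-dk, φ k)` of the mapping cone of `φ`. -/
def coneι : K.X 0 ⟶ K.X 1 ⊞ J.X 0 :=
  biprod.lift (-K.d 0 1) (φ.f 0)

@[simp]
theorem coneD_fst (n : ℕ) : coneD φ n ≫ biprod.fst = -biprod.fst ≫ K.d (n + 1) (n + 2) := by
  unfold coneD
  ext <;> simp

@[simp]
theorem coneD_snd (n : ℕ) :
    coneD φ n ≫ biprod.snd = biprod.fst ≫ φ.f (n + 1) + biprod.snd ≫ J.d n (n + 1) := by
  unfold coneD
  ext <;> simp

@[simp]
theorem coneι_fst : coneι φ ≫ biprod.fst = -K.d 0 1 := biprod.lift_fst _ _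

@[simp]
theorem coneι_snd : coneι φ ≫ biprod.snd = φ.f 0 := biprod.lift_snd _ _

theorem coneD_comp_coneD (n : ℕ) : coneD φ n ≫ coneD φ (n + 1) = 0 := by
  refine biprod.hom_ext _ _ ?_ ?_ <;> simp [reassoc_of% coneD_fst φ n, reassoc_of% coneD_snd φ n]

theorem coneι_comp_coneD : coneι φ ≫ coneD φ 0 = 0 := by
  refine biprod.hom_ext _ _ ?_ ?_ <;> simp [reassoc_of% coneι_fst φ, reassoc_of% coneι_snd φ]

section

variable (hK : ∀ n, (ShortComplex.mk _ _ (K.d_comp_d n (n + 1) (n + 2))).Exact)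
  (hJ : ∀ n, (ShortComplex.mk _ _ (J.d_comp_d n (n + 1) (n + 2))).Exact)

section

variable {B : A} {a : B ⟶ K.X 0} {b : B ⟶ J.X 0} (wa : a ≫ K.d 0 1 = 0) (wb : b ≫ J.d 0 1 = 0)
  (ha : (ShortComplex.mk _ _ wa).Exact) (hb : (ShortComplex.mk _ _ wb).Exact)
  (hab : a ≫ φ.f 0 = b)

-- An element killed by both components is a cycle of `K`, so it comes from `B`, where it is killed
-- by the monomorphism `b`.
include hab ha in
theorem mono_coneι [Mono b] : Mono (coneι φ) := by
  refine Preadditive.mono_of_cancel_zero _ fun {T} x hx => ?_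
  have h₁ : x ≫ K.d 0 1 = 0 := by simpa using hx =≫ biprod.fst
  have h₂ : x ≫ φ.f 0 = 0 := by simpa using hx =≫ biprod.snd
  obtain ⟨T', π, _, (t : T' ⟶ B), (ht : π ≫ x = t ≫ a)⟩ := ha.exact_up_to_refinements x h₁
  have : t ≫ b = 0 := by rw [← hab, ← reassoc_of% ht, h₂, comp_zero]
  rw [← cancel_epi π, ht, zero_of_comp_mono b this, zero_comp, comp_zero]

include wa hab hb hK in
theorem coneι_coneD_exact : (ShortComplex.mk _ _ (coneι_comp_coneD φ)).Exact := by
  rw [ShortComplex.exact_iff_exact_up_to_refinements]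
  intro T (x : T ⟶ K.X 1 ⊞ J.X 0) (hx : x ≫ coneD φ 0 = 0)
  have h₁ : (x ≫ biprod.fst) ≫ K.d 1 2 = 0 := by simpa using hx =≫ biprod.fst
  have h₂ : (x ≫ biprod.fst) ≫ φ.f 1 + (x ≫ biprod.snd) ≫ J.d 0 1 = 0 := by
    simpa using hx =≫ biprod.snd
  obtain ⟨T₁, π₁, _, (t : T₁ ⟶ K.X 0), (ht : π₁ ≫ x ≫ biprod.fst = t ≫ K.d 0 1)⟩ :=
    (hK 0).exact_up_to_refinements _ h₁
  -- Once the first component is written as `d t`, the second one corrected by `φ t` is a cycle of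
  -- `J`, hence comes from some `s` in `B`. The preimage is `a s - t`, with the sign of `-d` in the
  -- cone.
  have h₃ : (π₁ ≫ x ≫ biprod.snd + t ≫ φ.f 0) ≫ J.d 0 1 = 0 := by
    have := π₁ ≫= h₂
    simp only [Preadditive.comp_add, Category.assoc, reassoc_of% ht, comp_zero] at this
    rw [← this]
    simp [add_comm]
  obtain ⟨T₂, π₂, _, (s : T₂ ⟶ B), (hs : π₂ ≫ (π₁ ≫ x ≫ biprod.snd + t ≫ φ.f 0) = s ≫ b)⟩ :=
    hb.exact_up_to_refinements _ h₃
  refine ⟨T₂, π₂ ≫ π₁, epi_comp _ _, s ≫ a - π₂ ≫ t, ?_⟩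
  refine biprod.hom_ext _ _ ?_ ?_
  · simp [wa, ht]
  · simp only [Category.assoc, Preadditive.sub_comp, coneι_snd, hab, ← hs]
    simp

end

include hK hJ in
theorem coneD_coneD_exact (n : ℕ) : (ShortComplex.mk _ _ (coneD_comp_coneD φ n)).Exact := by
  rw [ShortComplex.exact_iff_exact_up_to_refinements]
  intro T (x : T ⟶ K.X (n + 2) ⊞ J.X (n + 1)) (hx : x ≫ coneD φ (n + 1) = 0)
  have h₁ : (x ≫ biprod.fst) ≫ K.d (n + 2) (n + 3) = 0 := by simpa using hx =≫ biprod.fst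
  have h₂ : (x ≫ biprod.fst) ≫ φ.f (n + 2) + (x ≫ biprod.snd) ≫ J.d (n + 1) (n + 2) = 0 := by
    simpa using hx =≫ biprod.snd
  obtain ⟨T₁, π₁, _, (t : T₁ ⟶ K.X (n + 1)),
    (ht : π₁ ≫ x ≫ biprod.fst = t ≫ K.d (n + 1) (n + 2))⟩ :=
    (hK (n + 1)).exact_up_to_refinements _ h₁
  have h₃ : (π₁ ≫ x ≫ biprod.snd + t ≫ φ.f (n + 1)) ≫ J.d (n + 1) (n + 2) = 0 := by
    have := π₁ ≫= h₂
    simp only [Preadditive.comp_add, Category.assoc, reassoc_of% ht, comp_zero] at this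
    rw [← this]
    simp [add_comm]
  obtain ⟨T₂, π₂, _, (s : T₂ ⟶ J.X n),
    (hs : π₂ ≫ (π₁ ≫ x ≫ biprod.snd + t ≫ φ.f (n + 1)) = s ≫ J.d n (n + 1))⟩ :=
    (hJ n).exact_up_to_refinements _ h₃
  -- The preimage is `(-t, s)`, the first component of the cone differential being `-d`.
  refine ⟨T₂, π₂ ≫ π₁, epi_comp _ _, s ≫ biprod.inr - π₂ ≫ t ≫ biprod.inl, ?_⟩
  refine biprod.hom_ext _ _ ?_ ?_
  · simp [ht]
  · simp only [Category.assoc, Preadditive.sub_comp, coneD_snd, Preadditive.comp_add,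
      biprod.inr_fst_assoc, biprod.inr_snd_assoc, biprod.inl_fst_assoc, biprod.inl_snd_assoc,
      zero_comp, comp_zero, ← hs]
    simp

end

/-! ### The image of the cone under an additive functor -/

section Map

variable {D : Type*} [Category* D] [Abelian D] (H : A ⥤ D) [H.Additive]

/-- If `H` maps the mapping cone of `φ` to an exact complex, then `H φ` is a quasi-isomorphism. -/
theorem isIso_homologyMap_of_cone_exact [Mono (H.map (coneι φ))]
    (h₀ : ((ShortComplex.mk _ _ (coneι_comp_coneD φ)).map H).Exact)
    (h : ∀ n, ((ShortComplex.mk _ _ (coneD_comp_coneD φ n)).map H).Exact) (i : ℕ) :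
    IsIso (HomologicalComplex.homologyMap
      ((H.mapHomologicalComplex (ComplexShape.up ℕ)).map φ) i) := by
  have fst (n) : H.map (coneD φ n) ≫ H.map biprod.fst =
      -(H.map biprod.fst ≫ H.map (K.d (n + 1) (n + 2))) := by
    simp only [← H.map_comp, coneD_fst, H.map_neg]
  have snd (n) : H.map (coneD φ n) ≫ H.map biprod.snd =
      H.map biprod.fst ≫ H.map (φ.f (n + 1)) + H.map biprod.snd ≫ H.map (J.d n (n + 1)) := by
    simp only [← H.map_comp, coneD_snd, H.map_add]
  have fst₀ : H.map (coneι φ) ≫ H.map biprod.fst = -H.map (K.d 0 1) := by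
    simp only [← H.map_comp, coneι_fst, H.map_neg]
  have snd₀ : H.map (coneι φ) ≫ H.map biprod.snd = H.map (φ.f 0) := by
    simp only [← H.map_comp, coneι_snd]
  have inl (n) : H.map (biprod.inl : K.X (n + 1) ⟶ _ ⊞ J.X n) ≫ H.map (coneD φ n) =
      -(H.map (K.d (n + 1) (n + 2)) ≫ H.map biprod.inl) +
        H.map (φ.f (n + 1)) ≫ H.map biprod.inr := by
    simp only [← H.map_comp, ← H.map_neg, ← H.map_add]
    congr 1
    ext <;> simp
  have inr (n) : H.map (biprod.inr : J.X n ⟶ K.X (n + 1) ⊞ _) ≫ H.map (coneD φ n) =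
      H.map (J.d n (n + 1)) ≫ H.map biprod.inr := by
    simp only [← H.map_comp]
    congr 1
    ext <;> simp
  have inl_fst {X Y : A} : H.map (biprod.inl : X ⟶ X ⊞ Y) ≫ H.map biprod.fst = 𝟙 _ := by
    rw [← H.map_comp, biprod.inl_fst, H.map_id]
  have inr_snd {X Y : A} : H.map (biprod.inr : Y ⟶ X ⊞ Y) ≫ H.map biprod.snd = 𝟙 _ := by
    rw [← H.map_comp, biprod.inr_snd, H.map_id]
  have inl_snd {X Y : A} : H.map (biprod.inl : X ⟶ X ⊞ Y) ≫ H.map biprod.snd = 0 := by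
    rw [← H.map_comp, biprod.inl_snd, H.map_zero]
  have inr_fst {X Y : A} : H.map (biprod.inr : Y ⟶ X ⊞ Y) ≫ H.map biprod.fst = 0 := by
    rw [← H.map_comp, biprod.inr_fst, H.map_zero]
  have : Mono (HomologicalComplex.homologyMap
      ((H.mapHomologicalComplex (ComplexShape.up ℕ)).map φ) i) := by
    cases i with
    | zero =>
      rw [HomologicalComplex.mono_homologyMap_iff_up_to_refinements _ 0 0 1 (by simp) (by simp)]
      intro T (x : T ⟶ H.obj (K.X 0)) (hx : x ≫ H.map (K.d 0 1) = 0) y hy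
      -- The predecessor of degree `0` is `0` itself, with zero differential: being a boundary means
      -- being zero.
      replace hy : x ≫ H.map (φ.f 0) = 0 := by
        refine Eq.trans hy ?_
        rw [HomologicalComplex.shape _ 0 0 (by simp)]
        exact comp_zero
      have hx' : x ≫ H.map (coneι φ) = 0 := by
        have e : coneι φ = -K.d 0 1 ≫ biprod.inl + φ.f 0 ≫ biprod.inr := by ext <;> simp
        simp only [e, H.map_add, H.map_neg, H.map_comp, Preadditive.comp_add, Preadditive.comp_neg,
          reassoc_of% hx, reassoc_of% hy, zero_comp, neg_zero, add_zero]
      have : x = 0 := zero_of_comp_mono _ hx'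
      subst this
      exact ⟨T, 𝟙 T, inferInstance, 0, comp_zero.trans zero_comp.symm⟩
    | succ n =>
      rw [HomologicalComplex.mono_homologyMap_iff_up_to_refinements _ n (n + 1) (n + 2)
        (by simp) (by simp)]
      intro T (x : T ⟶ H.obj (K.X (n + 1))) (hx : x ≫ H.map (K.d (n + 1) (n + 2)) = 0)
        (y : T ⟶ H.obj (J.X n)) (hy : x ≫ H.map (φ.f (n + 1)) = y ≫ H.map (J.d n (n + 1)))
      -- If `φ x = d y`, then `(x, -y)` is a cycle of the cone. Writing it as a boundary of an
      -- element with first component `t` gives `x = -d t`.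
      have hz : (x ≫ H.map biprod.inl - y ≫ H.map biprod.inr) ≫ H.map (coneD φ n) = 0 := by
        simp only [Preadditive.sub_comp, Category.assoc, inl, inr, Preadditive.comp_add,
          Preadditive.comp_neg, reassoc_of% hx, reassoc_of% hy, zero_comp, neg_zero, zero_add,
          sub_self]
      cases n with
      | zero =>
        obtain ⟨T', π, _, (t : T' ⟶ H.obj (K.X 0)), (ht : π ≫ _ = t ≫ H.map (coneι φ))⟩ :=
          h₀.exact_up_to_refinements _ hz
        refine ⟨T', π, inferInstance, -t, ?_⟩
        change π ≫ x = (-t) ≫ H.map (K.d 0 1)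
        have := ht =≫ H.map biprod.fst
        simpa [inl_fst, inr_fst, fst₀] using this
      | succ n =>
        obtain ⟨T', π, _, (t : T' ⟶ H.obj (K.X (n + 1) ⊞ J.X n)),
          (ht : π ≫ _ = t ≫ H.map (coneD φ n))⟩ := (h n).exact_up_to_refinements _ hz
        refine ⟨T', π, inferInstance, (-t) ≫ H.map biprod.fst, ?_⟩
        change π ≫ x = ((-t) ≫ _) ≫ H.map (K.d (n + 1) (n + 2))
        have := ht =≫ H.map biprod.fst
        simpa [inl_fst, inr_fst, fst] using this
  have : Epi (HomologicalComplex.homologyMap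
      ((H.mapHomologicalComplex (ComplexShape.up ℕ)).map φ) i) := by
    cases i with
    | zero =>
      rw [HomologicalComplex.epi_homologyMap_iff_up_to_refinements _ 0 0 1 (by simp) (by simp)]
      intro T (y : T ⟶ H.obj (J.X 0)) (hy : y ≫ H.map (J.d 0 1) = 0)
      obtain ⟨T', π, _, (t : T' ⟶ H.obj (K.X 0)),
        (ht : π ≫ y ≫ H.map biprod.inr = t ≫ H.map (coneι φ))⟩ :=
        h₀.exact_up_to_refinements (y ≫ H.map biprod.inr) (by
          change (y ≫ H.map biprod.inr) ≫ H.map (coneD φ 0) = 0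
          rw [Category.assoc, inr, reassoc_of% hy, zero_comp])
      refine ⟨T', π, inferInstance, t, ?_, 0, ?_⟩
      · change t ≫ H.map (K.d 0 1) = 0
        have := ht =≫ H.map biprod.fst
        simpa [inr_fst, fst₀] using this.symm
      · refine Eq.trans ?_ ((add_zero _).symm.trans (congrArg _ zero_comp.symm))
        change π ≫ y = t ≫ H.map (φ.f 0)
        have := ht =≫ H.map biprod.snd
        simpa [inr_snd, snd₀] using this
    | succ n =>
      rw [HomologicalComplex.epi_homologyMap_iff_up_to_refinements _ n (n + 1) (n + 2)
        (by simp) (by simp)]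
      intro T (y : T ⟶ H.obj (J.X (n + 1))) (hy : y ≫ H.map (J.d (n + 1) (n + 2)) = 0)
      -- A cycle `y` of `H J` gives the cycle `(0, y)` of the cone; if it is the boundary of `(k,
      -- j)`, then `d k = 0` and `y = φ k + d j`.
      obtain ⟨T', π, _, (t : T' ⟶ H.obj (K.X (n + 1) ⊞ J.X n)),
        (ht : π ≫ y ≫ H.map biprod.inr = t ≫ H.map (coneD φ n))⟩ :=
        (h n).exact_up_to_refinements (y ≫ H.map biprod.inr) (by
          change (y ≫ H.map biprod.inr) ≫ H.map (coneD φ (n + 1)) = 0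
          rw [Category.assoc, inr, reassoc_of% hy, zero_comp])
      refine ⟨T', π, inferInstance, t ≫ H.map biprod.fst, ?_, t ≫ H.map biprod.snd, ?_⟩
      · change (t ≫ H.map biprod.fst) ≫ H.map (K.d (n + 1) (n + 2)) = 0
        have := ht =≫ H.map biprod.fst
        simpa [inr_fst, fst] using this.symm
      · change π ≫ y = (t ≫ H.map biprod.fst) ≫ H.map (φ.f (n + 1)) +
          (t ≫ H.map biprod.snd) ≫ H.map (J.d n (n + 1))
        have := ht =≫ H.map biprod.snd
        simpa [inr_snd, snd] using this
  exact isIso_of_mono_of_epi _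

end Map

open Abelian in
/-- A morphism between acyclic resolutions of the same object is mapped to a
quasi-isomorphism. -/
theorem isIso_homologyMap_of_extAcyclic [HasExt.{w} A] {H : A ⥤ AddCommGrpCat.{u}}
    {L : AddCommGrpCat.{u} ⥤ A} (adj : L ⊣ H) [H.Additive]
    (hK : ∀ n, (ShortComplex.mk _ _ (K.d_comp_d n (n + 1) (n + 2))).Exact)
    (hJ : ∀ n, (ShortComplex.mk _ _ (J.d_comp_d n (n + 1) (n + 2))).Exact)
    {B : A} {a : B ⟶ K.X 0} {b : B ⟶ J.X 0} (wa : a ≫ K.d 0 1 = 0) (wb : b ≫ J.d 0 1 = 0)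
    (ha : (ShortComplex.mk _ _ wa).Exact) (hb : (ShortComplex.mk _ _ wb).Exact)
    (hab : a ≫ φ.f 0 = b) (hm : Mono b)
    (aK : ∀ n, ExtAcyclic (corepresenting L) (K.X n))
    (aJ : ∀ n, ExtAcyclic (corepresenting L) (J.X n)) (i : ℕ) :
    IsIso (HomologicalComplex.homologyMap
      ((H.mapHomologicalComplex (ComplexShape.up ℕ)).map φ) i) := by
  have := mono_coneι φ wa ha hab
  have ex₀ := coneι_coneD_exact φ hK wa wb hb hab
  have : PreservesLimitsOfSize.{0, 0} H := adj.rightAdjoint_preservesLimits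
  have hcone (n) : ExtAcyclic (corepresenting L) (K.X (n + 1) ⊞ J.X n) :=
    ExtAcyclic.of_sum_comp_eq_id (ι := Bool)
      (C := fun x => match x with | true => K.X (n + 1) | false => J.X n)
      (fun x => match x with | true => biprod.fst | false => biprod.snd)
      (fun x => match x with | true => biprod.inl | false => biprod.inr)
      (by simp)
      (fun x => match x with | true => aK _ | false => aJ _)
  -- By exactness at the start of the cone, this kernel is `K.X 0`.
  have hker : ExtAcyclic (corepresenting L) (kernel (coneD φ 0)) :=
    ExtAcyclic.of_iso (IsLimit.conePointUniqueUpToIso ex₀.fIsKernel (limit.isLimit _)) (aK 0)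
  refine isIso_homologyMap_of_cone_exact φ H
    (ex₀.map_of_mono_of_preservesKernel H inferInstance inferInstance) (fun n => ?_) i
  exact map_exact_of_extAcyclic adj (d := coneD φ) (coneD_coneD_exact φ hK hJ) hcone hker n

end Cone

/-! ### Extension along a functor with a partially defined left adjoint -/

/-- A functor `incl : Z ⥤ S` between preorders and a left adjoint `refl` of `incl`, defined on a
lower subset `dom` of `S` which contains the image of `incl`. -/
structure PartialReflection (Z S : Type u) [Preorder Z] [Preorder S] where
  /-- the functor -/
  incl : Z ⥤ S
  /-- the domain of the left adjoint -/
  dom : S → Prop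
  /-- the left adjoint on objects -/
  refl : ∀ s, dom s → Z
  dom_of_hom : ∀ {s t : S}, (s ⟶ t) → dom t → dom s
  /-- the left adjoint on morphisms -/
  reflMap : ∀ {s t : S} (_ : s ⟶ t) (hs : dom s) (ht : dom t), refl s hs ⟶ refl t ht
  dom_incl : ∀ z, dom (incl.obj z)
  /-- the unit of the adjunction -/
  unit : ∀ (s : S) (h : dom s), s ⟶ incl.obj (refl s h)
  /-- the counit of the adjunction -/
  counit : ∀ (z : Z) (h : dom (incl.obj z)), refl (incl.obj z) h ⟶ z

namespace PartialReflection

section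

variable {Z S : Type u} [Preorder Z] [Preorder S] (R : PartialReflection Z S)

/-- The right adjoint of the inverse image along `R.incl`: it sends `F` to the functor which is
`F (R.refl s)` at the points `s` of the domain of `R.refl`, and zero elsewhere. -/
def extend : (Z ⥤ AddCommGrpCat.{u}) ⥤ (S ⥤ AddCommGrpCat.{u}) where
  obj F :=
    -- A product indexed by a proposition is the single factor or zero, which avoids a case
    -- distinction in the definition of the morphisms.
    { obj := fun s => ∏ᶜ fun h : PLift (R.dom s) => F.obj (R.refl s h.down)
      map := fun {s _} g => Pi.lift fun h =>
        Pi.π (fun h : PLift (R.dom s) => F.obj (R.refl s h.down)) ⟨R.dom_of_hom g h.down⟩ ≫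
          F.map (R.reflMap g (R.dom_of_hom g h.down) h.down)
      map_id := fun s => Pi.hom_ext _ _ fun ⟨h⟩ => by
        have e : R.reflMap (𝟙 s) h h = 𝟙 _ := Subsingleton.elim _ _
        rw [Pi.lift_π, e, F.map_id, Category.comp_id, Category.id_comp]
      map_comp := fun {s _ _} g k => Pi.hom_ext _ _ fun ⟨h⟩ => by
        simp only [Category.assoc, Pi.lift_π, Pi.lift_π_assoc, ← F.map_comp]
        congr 1 }
  map φ :=
    { app := fun s => Limits.Pi.map fun h => φ.app (R.refl s h.down)
      naturality := fun s t g => Pi.hom_ext _ _ fun h => by simp }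
  map_id F := by
    ext s : 2
    exact Pi.hom_ext _ _ fun h => by simp
  map_comp φ ψ := by
    ext s : 2
    exact Pi.hom_ext _ _ fun h => by simp

/-- The projection from the value of an extension at a point of the domain. -/
def extendπ (F : Z ⥤ AddCommGrpCat.{u}) (s : S) (h : R.dom s) :
    (R.extend.obj F).obj s ⟶ F.obj (R.refl s h) :=
  Pi.π (fun h : PLift (R.dom s) => F.obj (R.refl s h.down)) ⟨h⟩

variable {R} in
theorem extend_hom_ext {F : Z ⥤ AddCommGrpCat.{u}} {s : S} {T : AddCommGrpCat.{u}}
    {a b : T ⟶ (R.extend.obj F).obj s} (w : ∀ h, a ≫ R.extendπ F s h = b ≫ R.extendπ F s h) :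
    a = b :=
  Pi.hom_ext _ _ fun h => w h.down

@[simp]
theorem extend_obj_map_π (F : Z ⥤ AddCommGrpCat.{u}) {s t : S} (g : s ⟶ t)
    (h : R.dom t) :
    (R.extend.obj F).map g ≫ R.extendπ F t h =
      R.extendπ F s (R.dom_of_hom g h) ≫ F.map (R.reflMap g _ h) :=
  Pi.lift_π _ _

@[simp]
theorem extend_map_app_π {F G : Z ⥤ AddCommGrpCat.{u}} (φ : F ⟶ G) (s : S)
    (h : R.dom s) :
    (R.extend.map φ).app s ≫ R.extendπ G s h = R.extendπ F s h ≫ φ.app _ :=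
  Limits.Pi.map_π (fun h : PLift (R.dom s) => φ.app (R.refl s h.down)) ⟨h⟩

/-- A morphism to the value of an extension. -/
def extendLift (F : Z ⥤ AddCommGrpCat.{u}) (s : S) {T : AddCommGrpCat.{u}}
    (a : ∀ h, T ⟶ F.obj (R.refl s h)) : T ⟶ (R.extend.obj F).obj s :=
  Pi.lift fun h => a h.down

@[simp]
theorem extendLift_π (F : Z ⥤ AddCommGrpCat.{u}) (s : S) {T : AddCommGrpCat.{u}}
    (a : ∀ h, T ⟶ F.obj (R.refl s h)) (h : R.dom s) :
    R.extendLift F s a ≫ R.extendπ F s h = a h :=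
  Pi.lift_π _ _

instance (F : Z ⥤ AddCommGrpCat.{u}) (s : S) (h : R.dom s) : IsIso (R.extendπ F s h) :=
  ⟨R.extendLift F s fun _ => 𝟙 _, extend_hom_ext fun _ => by simp, by simp⟩

theorem isZero_extend_obj_obj (F : Z ⥤ AddCommGrpCat.{u}) {s : S} (h : ¬ R.dom s) :
    IsZero ((R.extend.obj F).obj s) := by
  rw [IsZero.iff_id_eq_zero]
  exact extend_hom_ext fun k => (h k).elim

/-- The inverse image along `R.incl`. -/
abbrev pullback : (S ⥤ AddCommGrpCat.{u}) ⥤ (Z ⥤ AddCommGrpCat.{u}) :=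
  (Functor.whiskeringLeft _ _ _).obj R.incl

/-- The inverse image is left adjoint to the extension. -/
def adj : R.pullback ⊣ R.extend :=
  Adjunction.mkOfHomEquiv
    { homEquiv := fun F G =>
        { toFun := fun φ =>
            { app := fun s => R.extendLift G s fun h => F.map (R.unit s h) ≫ φ.app (R.refl s h)
              naturality := fun s t g => extend_hom_ext fun h => by
                have := φ.naturality (R.reflMap g (R.dom_of_hom g h) h)
                dsimp at this
                simp only [Category.assoc, extendLift_π, extend_obj_map_π, reassoc_of% @extendLift_π,
                  ← this, ← F.map_comp_assoc]
                congr 1 }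
          invFun := fun ψ =>
            { app := fun z => ψ.app (R.incl.obj z) ≫ R.extendπ G _ (R.dom_incl z) ≫
                G.map (R.counit z _)
              naturality := fun z y g => by
                dsimp
                simp only [Category.assoc, NatTrans.naturality_assoc, reassoc_of% @extend_obj_map_π,
                  ← G.map_comp]
                congr 1 }
          left_inv := fun φ => by
            ext z : 2
            have := φ.naturality (R.counit z (R.dom_incl z))
            dsimp at this ⊢
            simp only [reassoc_of% @extendLift_π, Category.assoc, ← this, ← F.map_comp_assoc]
            rw [Subsingleton.elim (R.unit _ _ ≫ _) (𝟙 _), F.map_id, Category.id_comp]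
          right_inv := fun ψ => by
            ext s : 2
            refine extend_hom_ext fun h => ?_
            simp only [extendLift_π, NatTrans.naturality_assoc, reassoc_of% @extend_obj_map_π,
              ← G.map_comp]
            have e : R.reflMap (R.unit s h) h (R.dom_incl _) ≫ R.counit _ _ = 𝟙 _ :=
              Subsingleton.elim _ _
            rw [e, G.map_id, Category.comp_id] }
      homEquiv_naturality_left_symm := fun f g => by
        ext z : 2
        simp
      homEquiv_naturality_right := fun f g => by
        ext s : 2
        exact extend_hom_ext fun h => by simp [reassoc_of% @extendLift_π] }

@[simp]
theorem adj_unit_app_app_π (F : S ⥤ AddCommGrpCat.{u}) (s : S) (h : R.dom s) :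
    (R.adj.unit.app F).app s ≫ R.extendπ (R.pullback.obj F) s h = F.map (R.unit s h) := by
  refine (R.extendLift_π _ _ _ _).trans ?_
  exact Category.comp_id _

instance : R.extend.Additive where
  map_add := by
    intro F G φ ψ
    ext s : 2
    exact extend_hom_ext fun h => by simp

instance : R.extend.PreservesEpimorphisms where
  preserves {F G} φ _ := by
    rw [NatTrans.epi_iff_epi_app]
    intro s
    by_cases h : R.dom s
    · have e := R.extend_map_app_π φ s h
      have : Epi (φ.app (R.refl s h)) := inferInstance
      rw [← IsIso.eq_comp_inv] at e
      rw [e]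
      infer_instance
    · exact ⟨fun a b _ => (R.isZero_extend_obj_obj G h).eq_of_src _ _⟩

/-- A right adjoint preserves kernels; together with preservation of epimorphisms this gives
exactness. -/
instance : R.extend.PreservesHomology := by
  have : PreservesLimitsOfSize.{0, 0} R.extend := R.adj.rightAdjoint_preservesLimits
  exact Functor.preservesHomology_of_preservesEpis_and_kernels _

instance : R.pullback.PreservesMonomorphisms where
  preserves φ _ := by
    rw [NatTrans.mono_iff_mono_app]
    intro z
    exact (NatTrans.mono_iff_mono_app φ).1 inferInstance _

instance (I : Z ⥤ AddCommGrpCat.{u}) [Injective I] : Injective (R.extend.obj I) :=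
  Injective.injective_of_adjoint R.adj I

/-- The limit of an extension. -/
def extendCompLim : R.extend ⋙ (lim : (S ⥤ AddCommGrpCat.{u}) ⥤ _) ≅ lim :=
  -- The inverse image of a constant functor is the same constant functor, so both sides are right
  -- adjoint to `const`.
  Adjunction.rightAdjointUniq (constLimAdj.comp R.adj)
    (constLimAdj (J := Z) (C := AddCommGrpCat.{u}))

/-- Needed because homological triviality concerns the canonical map from `G` to the sections, not
merely an abstract isomorphism. -/
theorem unit_extendCompLim (G : AddCommGrpCat.{u}) :
    constLimAdj.unit.app G ≫ lim.map (R.adj.unit.app ((Functor.const S).obj G)) ≫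
      R.extendCompLim.hom.app ((Functor.const Z).obj G) =
    (constLimAdj (J := Z) (C := AddCommGrpCat.{u})).unit.app G := by
  have := Adjunction.unit_rightAdjointUniq_hom_app (constLimAdj.comp R.adj)
    (constLimAdj (J := Z) (C := AddCommGrpCat.{u})) G
  rw [Adjunction.comp_unit_app, Category.assoc] at this
  exact this

end

end PartialReflection

/-! ### Right derived functors and exact functors which preserve injective objects -/

section MapInjectiveResolution

variable {A A' D : Type*} [Category* A] [Category* A'] [Category* D] [Abelian A] [Abelian A']
  [Abelian D]

/-- The image of an injective resolution by an exact functor which preserves injective objects. -/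
def mapInjectiveResolution (T : A ⥤ A') [T.Additive] [T.PreservesHomology]
    (hT : ∀ I : A, Injective I → Injective (T.obj I)) {F : A} (I : InjectiveResolution F) :
    InjectiveResolution (T.obj F) where
  cocomplex := (T.mapHomologicalComplex _).obj I.cocomplex
  injective n := hT _ (I.injective n)
  ι := ((HomologicalComplex.singleMapHomologicalComplex T (ComplexShape.up ℕ) 0).inv.app F) ≫
    (T.mapHomologicalComplex _).map I.ι
  quasiIso := inferInstance

/-- If `T` is exact and preserves injective objects, then `Rⁱ H (T F) ≅ Rⁱ H' F` for
`H' ≅ T ⋙ H`. -/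
def rightDerivedObjIso [HasInjectiveResolutions A] [HasInjectiveResolutions A'] (T : A ⥤ A')
    [T.Additive] [T.PreservesHomology] (hT : ∀ I : A, Injective I → Injective (T.obj I))
    (H : A' ⥤ D) [H.Additive] (H' : A ⥤ D) [H'.Additive] (e : T ⋙ H ≅ H') (i : ℕ) (F : A) :
    (H.rightDerived i).obj (T.obj F) ≅ (H'.rightDerived i).obj F :=
  (mapInjectiveResolution T hT (injectiveResolution F)).isoRightDerivedObj H i ≪≫
    (HomologicalComplex.homologyFunctor _ _ i).mapIso
      ((NatIso.mapHomologicalComplex e (ComplexShape.up ℕ)).app _) ≪≫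
    ((injectiveResolution F).isoRightDerivedObj H' i).symm

end MapInjectiveResolution

/-! ### Properties of the comparison of right derived functors -/

section MapHomology

variable {B D : Type*} [Category* B] [Category* D] [Abelian B] [Abelian D]

/-- Allows the comparison of derived functors to be computed on cycles, as is needed to identify it
in degree zero. -/
theorem map_homologyπ_comp_mapHomologyIso_inv (S : ShortComplex B) (E : B ⥤ D) [E.Additive]
    [E.PreservesHomology] :
    E.map S.homologyπ ≫ (S.mapHomologyIso E).inv = (S.mapCyclesIso E).inv ≫
      (S.map E).homologyπ := by
  let h := S.leftHomologyData
  have e₁ : (S.mapHomologyIso E).inv = E.map h.homologyIso.hom ≫ (h.map E).homologyIso.inv := by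
    rw [h.mapHomologyIso_eq E]
    rfl
  have e₂ : (S.mapCyclesIso E).inv = E.map h.cyclesIso.hom ≫ (h.map E).cyclesIso.inv := by
    rw [h.mapCyclesIso_eq E]
    rfl
  have e₃ : E.map h.π ≫ (h.map E).homologyIso.inv =
      (h.map E).cyclesIso.inv ≫ (S.map E).homologyπ :=
    (h.map E).π_comp_homologyIso_inv
  have e₄ : E.map S.homologyπ ≫ E.map h.homologyIso.hom = E.map h.cyclesIso.hom ≫ E.map h.π := by
    rw [← E.map_comp, ← E.map_comp, h.homologyπ_comp_homologyIso_hom]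
  rw [e₁, e₂]
  exact (Category.assoc _ _ _).symm.trans ((congrArg (· ≫ (h.map E).homologyIso.inv) e₄).trans
    ((Category.assoc _ _ _).trans ((congrArg (E.map h.cyclesIso.hom ≫ ·) e₃).trans
      (Category.assoc _ _ _).symm)))

theorem map_iCycles (S : ShortComplex B) (E : B ⥤ D) [E.Additive] [E.PreservesHomology] :
    (S.mapCyclesIso E).inv ≫ (S.map E).iCycles = E.map S.iCycles :=
  (Iso.inv_comp_eq _).2 (S.mapCyclesIso_hom_iCycles E).symm

variable (E : B ⥤ D) [E.Additive] [E.PreservesHomology] (K : CochainComplex B ℕ)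

/-- An exact functor commutes with the homology of complexes. -/
def mapHomologyObjIso (i : ℕ) :
    E.obj (K.homology i) ≅ ((E.mapHomologicalComplex (ComplexShape.up ℕ)).obj K).homology i :=
  ((K.sc i).mapHomologyIso E).symm

/-- An exact functor commutes with the cycles of complexes. -/
def mapCyclesObjIso (i : ℕ) :
    E.obj (K.cycles i) ≅ ((E.mapHomologicalComplex (ComplexShape.up ℕ)).obj K).cycles i :=
  ((K.sc i).mapCyclesIso E).symm

theorem map_homologyπ_mapHomologyObjIso (i : ℕ) :
    E.map (K.homologyπ i) ≫ (mapHomologyObjIso E K i).hom = (mapCyclesObjIso E K i).hom ≫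
      HomologicalComplex.homologyπ _ i :=
  map_homologyπ_comp_mapHomologyIso_inv (K.sc i) E

theorem mapCyclesObjIso_iCycles (i : ℕ) :
    (mapCyclesObjIso E K i).hom ≫ HomologicalComplex.iCycles _ i = E.map (K.iCycles i) :=
  map_iCycles (K.sc i) E

end MapHomology

section DerivedComparison

universe w

variable {A A' B D : Type*} [Category* A] [Category* A'] [Category* B] [Category* D]
  [Abelian A] [Abelian A'] [Abelian B] [Abelian D] [HasInjectiveResolutions A]
  [HasInjectiveResolutions A']

omit [HasInjectiveResolutions A] in
theorem mono_injectiveResolution_ι {F : A} (I : InjectiveResolution F) : Mono (I.ι.f 0) :=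
  inferInstance

/-- Right derived functors are the homology of the image of an injective resolution. -/
def rightDerivedIsoHomology (G : A ⥤ B) [G.Additive] {F : A} (I : InjectiveResolution F) (i : ℕ) :
    (G.rightDerived i).obj F ≅
      ((G.mapHomologicalComplex (ComplexShape.up ℕ)).obj I.cocomplex).homology i :=
  I.isoRightDerivedObj G i

theorem toRightDerivedZero_rightDerivedIsoHomology (G : A ⥤ B) [G.Additive] {F : A}
    (I : InjectiveResolution F) :
    G.toRightDerivedZero.app F ≫ (rightDerivedIsoHomology G I 0).hom =
      I.toRightDerivedZero' G ≫ HomologicalComplex.homologyπ _ 0 := by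
  have := (Iso.eq_comp_inv (rightDerivedIsoHomology G I 0)).1
    ((I.toRightDerivedZero_eq G).trans (Category.assoc _ _ _).symm)
  exact this

section

variable (G : A ⥤ B) [G.Additive] (E : B ⥤ D) [E.Additive]
  [E.PreservesHomology] (r : A ⥤ A') [r.Additive] [r.PreservesHomology] (H : A' ⥤ D)
  [H.Additive] (θ : G ⋙ E ⟶ r ⋙ H) (F : A)

/-- The morphism of complexes which induces the comparison of right derived functors. -/
def derivedComparisonComplexMap :
    (E.mapHomologicalComplex (ComplexShape.up ℕ)).obj
      ((G.mapHomologicalComplex (ComplexShape.up ℕ)).obj (injectiveResolution F).cocomplex) ⟶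
    (H.mapHomologicalComplex (ComplexShape.up ℕ)).obj
      (injectiveResolution (r.obj F)).cocomplex :=
  (NatTrans.mapHomologicalComplex θ (ComplexShape.up ℕ)).app (injectiveResolution F).cocomplex ≫
    (H.mapHomologicalComplex (ComplexShape.up ℕ)).map
      (comparison r (injectiveResolution F) (injectiveResolution (r.obj F)))

theorem derivedComparison_eq (i : ℕ) :
    derivedComparison G E r H θ i F =
      E.map (rightDerivedIsoHomology G (injectiveResolution F) i).hom ≫
        (mapHomologyObjIso E _ i).hom ≫
          HomologicalComplex.homologyMap (derivedComparisonComplexMap G E r H θ F) i ≫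
            (rightDerivedIsoHomology H (injectiveResolution (r.obj F)) i).inv :=
  rfl

/-- In degree zero, the comparison of right derived functors extends `θ`. -/
theorem toRightDerivedZero_derivedComparison :
    E.map (G.toRightDerivedZero.app F) ≫ derivedComparison G E r H θ 0 F =
      θ.app F ≫ H.toRightDerivedZero.app (r.obj F) := by
  let I := injectiveResolution F
  let J := injectiveResolution (r.obj F)
  have e₂ : E.map (I.toRightDerivedZero' G) ≫ (mapCyclesObjIso E _ 0).hom ≫
      HomologicalComplex.cyclesMap (derivedComparisonComplexMap G E r H θ F) 0 =
        θ.app F ≫ J.toRightDerivedZero' H := by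
    rw [← cancel_mono (HomologicalComplex.iCycles _ 0)]
    simp only [Category.assoc, HomologicalComplex.cyclesMap_i]
    rw [reassoc_of% @mapCyclesObjIso_iCycles]
    have e₃ : E.map (I.toRightDerivedZero' G) ≫ E.map (HomologicalComplex.iCycles _ 0) =
        E.map (G.map (I.ι.f 0)) := by
      rw [← E.map_comp, I.toRightDerivedZero'_comp_iCycles G]
      rfl
    -- Naturality of `θ` at `F ⟶ I⁰`, combined with the fact that `comparison r I J` extends the
    -- identity of `r F`.
    have e₄ : θ.app F ≫ H.map (J.ι.f 0) =
        E.map (G.map (I.ι.f 0)) ≫ (derivedComparisonComplexMap G E r H θ F).f 0 := by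
      rw [← comparison_comm r I J]
      refine (congrArg (θ.app F ≫ ·) (H.map_comp _ _)).trans ?_
      exact (Category.assoc _ _ _).symm.trans
        ((congrArg (· ≫ H.map ((comparison r I J).f 0)) (θ.naturality (I.ι.f 0)).symm).trans
          (Category.assoc _ _ _))
    exact (Category.assoc _ _ _).symm.trans
      ((congrArg (· ≫ (derivedComparisonComplexMap G E r H θ F).f 0) e₃).trans
        (e₄.symm.trans (congrArg (θ.app F ≫ ·) (J.toRightDerivedZero'_comp_iCycles H).symm)))
  have e₃ := toRightDerivedZero_rightDerivedIsoHomology H J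
  rw [← Iso.eq_comp_inv] at e₃
  rw [derivedComparison_eq, ← E.map_comp_assoc, toRightDerivedZero_rightDerivedIsoHomology,
    E.map_comp_assoc, reassoc_of% @map_homologyπ_mapHomologyObjIso,
    HomologicalComplex.homologyπ_naturality_assoc, reassoc_of% e₂]
  refine congrArg (θ.app F ≫ ·) ?_
  rw [e₃, Category.assoc]

/-- Left exact functors agree with their zeroth derived functors, so `θ` at `F` is the comparison in
degree zero. -/
theorem isIso_app_of_isIso_derivedComparison [PreservesFiniteLimits G] [PreservesFiniteLimits H]
    [IsIso (derivedComparison G E r H θ 0 F)] : IsIso (θ.app F) := by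
  have h := toRightDerivedZero_derivedComparison G E r H θ F
  have : IsIso (θ.app F ≫ H.toRightDerivedZero.app (r.obj F)) := by
    rw [← h]
    infer_instance
  exact IsIso.of_isIso_comp_right (θ.app F) (H.toRightDerivedZero.app (r.obj F))

end

/-- If `θ` is an isomorphism and `r` is acyclic on injective objects, then the comparison of right
derived functors is an isomorphism. -/
theorem isIso_derivedComparison [HasExt.{w} A'] (G : A ⥤ B) [G.Additive]
    (E : B ⥤ AddCommGrpCat.{u}) [E.Additive] [E.PreservesHomology] (r : A ⥤ A') [r.Additive]
    [r.PreservesHomology] {H : A' ⥤ AddCommGrpCat.{u}} {L : AddCommGrpCat.{u} ⥤ A'}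
    (adj : L ⊣ H) [H.Additive] (θ : G ⋙ E ⟶ r ⋙ H)
    (hθ : ∀ I : A, Injective I → IsIso (θ.app I))
    (hr : ∀ I : A, Injective I → ExtAcyclic (corepresenting L) (r.obj I)) (i : ℕ) (F : A) :
    IsIso (derivedComparison G E r H θ i F) := by
  let I := injectiveResolution F
  let J := injectiveResolution (r.obj F)
  have : IsIso ((NatTrans.mapHomologicalComplex θ (ComplexShape.up ℕ)).app I.cocomplex) := by
    have : ∀ n, IsIso (((NatTrans.mapHomologicalComplex θ (ComplexShape.up ℕ)).app
        I.cocomplex).f n) := fun n => hθ _ (I.injective n)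
    exact HomologicalComplex.Hom.isIso_of_components _
  have hI := I.ι_f_zero_comp_complex_d
  -- `r I` is a resolution of `r F` by acyclic objects because `r` is exact, and the injective
  -- resolution `J` is acyclic too.
  have : IsIso (HomologicalComplex.homologyMap
      ((H.mapHomologicalComplex (ComplexShape.up ℕ)).map (comparison r I J)) i) :=
    isIso_homologyMap_of_extAcyclic (comparison r I J) adj (fun n => (I.exact_succ n).map r)
      J.exact_succ (a := r.map (I.ι.f 0)) (b := J.ι.f 0)
      ((r.map_comp _ _).symm.trans ((congrArg r.map hI).trans (r.map_zero _ _)))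
      J.ι_f_zero_comp_complex_d (I.exact₀.map r) J.exact₀ (comparison_comm r I J)
      (mono_injectiveResolution_ι J)
      (fun n => hr _ (I.injective n)) (fun n i => Abelian.Ext.subsingleton_of_injective _ _ _) i
  have : IsIso (HomologicalComplex.homologyMap (derivedComparisonComplexMap G E r H θ F) i) := by
    have e : HomologicalComplex.homologyMap (derivedComparisonComplexMap G E r H θ F) i = _ :=
      HomologicalComplex.homologyMap_comp _ _ i
    have e' : IsIso (HomologicalComplex.homologyMap
      ((NatTrans.mapHomologicalComplex θ (ComplexShape.up ℕ)).app I.cocomplex) i) := inferInstance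
    rw [e]
    exact IsIso.comp_isIso' e' this
  rw [derivedComparison_eq]
  infer_instance

end DerivedComparison

/-! ### Skyscrapers -/

section Skyscraper

variable {X : Type u} [TopologicalSpace X]

/-- The inclusion of the point `x`, whose left adjoint is defined on the closure of `x`. -/
def pointReflection (x : X) :
    PartialReflection (Specialization PUnit.{u + 1}) (Specialization X) where
  incl := (Functor.const _).obj (Specialization.toEquiv x)
  dom p := p ≤ Specialization.toEquiv x
  refl _ _ := Specialization.toEquiv PUnit.unit
  dom_of_hom g h := g.le.trans h
  reflMap _ _ _ := 𝟙 _
  dom_incl _ := le_rfl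
  unit _ h := homOfLE h
  counit _ _ := 𝟙 _

/-- The skyscraper at `x`, i.e. the direct image along the inclusion of the point `x`. -/
abbrev skyscraper (x : X) : AbData PUnit.{u + 1} ⥤ AbData X := (pointReflection x).extend

/-- The value of abelian data on the one point space. -/
abbrev pointValue : AbData PUnit.{u + 1} ⥤ AddCommGrpCat.{u} := stalk PUnit.unit

/-- The projection from the value of a skyscraper at a point of the closure of `x`. -/
def skyscraperπ (x : X) (M : AbData PUnit.{u + 1}) {p : Specialization X}
    (h : p ≤ Specialization.toEquiv x) : ((skyscraper x).obj M).obj p ⟶ pointValue.obj M :=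
  (pointReflection x).extendπ M p h

theorem skyscraper_hom_ext {x : X} {M : AbData PUnit.{u + 1}} {p : Specialization X}
    {T : AddCommGrpCat.{u}} {a b : T ⟶ ((skyscraper x).obj M).obj p}
    (w : ∀ h, a ≫ skyscraperπ x M h = b ≫ skyscraperπ x M h) : a = b :=
  PartialReflection.extend_hom_ext w

@[simp]
theorem skyscraper_map_π (x : X) (M : AbData PUnit.{u + 1}) {p q : Specialization X} (g : p ⟶ q)
    (h : q ≤ Specialization.toEquiv x) :
    ((skyscraper x).obj M).map g ≫ skyscraperπ x M h = skyscraperπ x M (g.le.trans h) := by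
  refine ((pointReflection x).extend_obj_map_π M g h).trans ?_
  have : M.map ((pointReflection x).reflMap g (g.le.trans h) h) = 𝟙 _ := M.map_id _
  exact (congrArg (_ ≫ ·) this).trans (Category.comp_id _)

/-- A morphism to the value of a skyscraper. -/
def skyscraperLift (x : X) (M : AbData PUnit.{u + 1}) (p : Specialization X)
    {T : AddCommGrpCat.{u}} (a : T ⟶ pointValue.obj M) : T ⟶ ((skyscraper x).obj M).obj p :=
  (pointReflection x).extendLift M p fun _ => a

@[simp]
theorem skyscraperLift_π (x : X) (M : AbData PUnit.{u + 1}) {p : Specialization X}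
    {T : AddCommGrpCat.{u}} (a : T ⟶ pointValue.obj M) (h : p ≤ Specialization.toEquiv x) :
    skyscraperLift x M p a ≫ skyscraperπ x M h = a :=
  (pointReflection x).extendLift_π _ _ _ _

theorem specialization_val_le {S : Set X} {s t : Specialization S} :
    Specialization.toEquiv (Specialization.ofEquiv s).1 ≤
      Specialization.toEquiv (Specialization.ofEquiv t).1 ↔ s ≤ t :=
  (Topology.IsInducing.subtypeVal.specializes_iff (x := Specialization.ofEquiv t)
    (y := Specialization.ofEquiv s))

theorem sections_w {S : Set X} (F : AbData X) {s t : S}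
    (h : Specialization.toEquiv s.1 ≤ Specialization.toEquiv t.1) :
    sectionsπ S F s ≫ F.map (homOfLE h) = sectionsπ S F t :=
  limit.w ((restrict S).obj F)
    (homOfLE (specialization_val_le (s := Specialization.toEquiv s)
      (t := Specialization.toEquiv t).1 h))

/-- The canonical morphism `M ⟶ Γ(S, i_x M)`. -/
def toSectionsSkyscraper (S : Set X) (x : X) (M : AbData PUnit.{u + 1}) :
    pointValue.obj M ⟶ (sections S).obj ((skyscraper x).obj M) :=
  limit.lift ((restrict S).obj ((skyscraper x).obj M))
    { pt := pointValue.obj M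
      π :=
        { app := fun s => skyscraperLift x M (Specialization.toEquiv (Specialization.ofEquiv s).1)
            (𝟙 _)
          naturality := fun s t g => skyscraper_hom_ext fun h => by
            refine ((congrArg (· ≫ _) (Category.id_comp _)).trans
              (skyscraperLift_π x M (𝟙 _) h)).trans ?_
            refine Eq.trans ?_ (Category.assoc _ _ _).symm
            refine Eq.trans ?_ (congrArg (_ ≫ ·) (skyscraper_map_π x M _ h).symm)
            exact (skyscraperLift_π x M (𝟙 _) _).symm } }

@[simp]
theorem toSectionsSkyscraper_π (S : Set X) (x : X) (M : AbData PUnit.{u + 1}) (s : S) :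
    toSectionsSkyscraper S x M ≫ sectionsπ S _ s = skyscraperLift x M _ (𝟙 _) :=
  limit.lift_π _ _

theorem toSectionsSkyscraper_res {S T : Set X} (h : S ⊆ T) (x : X) (M : AbData PUnit.{u + 1}) :
    toSectionsSkyscraper T x M ≫ (sectionsRes h).app _ = toSectionsSkyscraper S x M :=
  sections_hom_ext fun s => by simp

theorem toSectionsSkyscraper_naturality (S : Set X) (x : X) {M N : AbData PUnit.{u + 1}}
    (φ : M ⟶ N) :
    pointValue.map φ ≫ toSectionsSkyscraper S x N =
      toSectionsSkyscraper S x M ≫ (sections S).map ((skyscraper x).map φ) := by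
  refine sections_hom_ext fun s => skyscraper_hom_ext fun h => ?_
  have e := sections_map_π S ((skyscraper x).map φ) s
  have e' : (toSectionsSkyscraper S x M ≫ (sections S).map ((skyscraper x).map φ)) ≫
      sectionsπ S _ s = skyscraperLift x M _ (𝟙 _) ≫ ((skyscraper x).map φ).app _ := by
    rw [Category.assoc, e, reassoc_of% @toSectionsSkyscraper_π]
  rw [e', Category.assoc, Category.assoc, Category.assoc, reassoc_of% @toSectionsSkyscraper_π,
    skyscraperLift_π, Category.comp_id]
  have : ((skyscraper x).map φ).app (Specialization.toEquiv s.1) ≫ skyscraperπ x N h =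
      skyscraperπ x M h ≫ pointValue.map φ :=
    (pointReflection x).extend_map_app_π φ _ h
  rw [this, reassoc_of% @skyscraperLift_π, Category.id_comp]

/-- The sections of a skyscraper on a set containing the point. -/
theorem isIso_toSectionsSkyscraper {S : Set X} {x : X} (hx : x ∈ S) (M : AbData PUnit.{u + 1}) :
    IsIso (toSectionsSkyscraper S x M) := by
  -- The inverse is evaluation at `x`: every `s ∈ S` with nonzero value satisfies `s ≤ x`, so a
  -- section is determined by its component at `x`.
  refine ⟨sectionsπ S _ ⟨x, hx⟩ ≫ skyscraperπ x M le_rfl, ?_, ?_⟩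
  · rw [reassoc_of% @toSectionsSkyscraper_π, skyscraperLift_π]
  · refine sections_hom_ext fun s => skyscraper_hom_ext fun h => ?_
    rw [Category.assoc, Category.assoc, reassoc_of% @toSectionsSkyscraper_π, skyscraperLift_π,
      Category.comp_id, Category.id_comp,
      ← sections_w ((skyscraper x).obj M) (s := s) (t := ⟨x, hx⟩) h, Category.assoc,
      skyscraper_map_π]

theorem isZero_skyscraper_obj_obj {x : X} (M : AbData PUnit.{u + 1}) {p : Specialization X}
    (h : ¬ p ≤ Specialization.toEquiv x) : IsZero (((skyscraper x).obj M).obj p) :=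
  (pointReflection x).isZero_extend_obj_obj M h

theorem isZero_restrict_skyscraper {S : Set X} {x : X} (M : AbData PUnit.{u + 1})
    (h : ∀ s ∈ S, ¬ Specialization.toEquiv s ≤ Specialization.toEquiv x) :
    IsZero ((restrict S).obj ((skyscraper x).obj M)) :=
  Functor.isZero _ fun s => isZero_skyscraper_obj_obj M (h _ (Specialization.ofEquiv s).2)

/-- The unit `F ⟶ i_x (F_x)` of the adjunction for the inclusion of the point `x`. -/
abbrev toSkyscraper (x : X) (F : AbData X) :
    F ⟶ (skyscraper x).obj ((pointReflection x).pullback.obj F) :=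
  (pointReflection x).adj.unit.app F

/-- An injective object is a direct summand of a product of skyscrapers. -/
theorem exists_sum_toSkyscraper_comp_eq_id [Finite X] (I : AbData X) [Injective I] :
    ∃ (n : ℕ) (x : Fin n → X)
      (b : ∀ j, (skyscraper (x j)).obj ((pointReflection (x j)).pullback.obj I) ⟶ I),
      ∑ j, toSkyscraper (x j) I ≫ b j = 𝟙 I := by
  have : HasFiniteBiproducts (AbData X) := Abelian.hasFiniteBiproducts
  obtain ⟨n, ⟨e⟩⟩ := Finite.exists_equiv_fin X
  let K (j : Fin n) : AbData X :=
    (skyscraper (e.symm j)).obj ((pointReflection (e.symm j)).pullback.obj I)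
  let a : I ⟶ ⨁ K := biproduct.lift fun j => toSkyscraper (e.symm j) I
  have : Mono a := by
    rw [NatTrans.mono_iff_mono_app]
    intro p
    obtain ⟨j, rfl⟩ : ∃ j, Specialization.toEquiv (e.symm j) = p := ⟨e p, e.symm_apply_apply p⟩
    have h₁ : a ≫ biproduct.π K j = toSkyscraper (e.symm j) I := biproduct.lift_π _ _
    -- At the point `p`, the component of `a` indexed by `p` itself is already a split monomorphism.
    have h₂ : (toSkyscraper (e.symm j) I).app (Specialization.toEquiv (e.symm j)) ≫
        (pointReflection (e.symm j)).extendπ _ _ le_rfl = 𝟙 _ :=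
      ((pointReflection (e.symm j)).adj_unit_app_app_π I _ le_rfl).trans (I.map_id _)
    rw [← h₁] at h₂
    exact (SplitMono.mk (f := a.app _) _ ((Category.assoc _ _ _).symm.trans h₂)).mono
  refine ⟨n, e.symm, fun j => biproduct.ι K j ≫ Injective.factorThru (𝟙 I) a, ?_⟩
  have h := Injective.comp_factorThru (𝟙 I) a
  have h' : ∑ j, biproduct.π K j ≫ biproduct.ι K j = 𝟙 (⨁ K) := biproduct.total
  rw [← Category.id_comp (Injective.factorThru (𝟙 I) a), ← h',
    Preadditive.sum_comp, Preadditive.comp_sum] at h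
  simpa [a] using h

end Skyscraper

/-! ### Skyscrapers and fibers -/

section Fiber

variable {X Y : Type u} [TopologicalSpace X] [TopologicalSpace Y]

instance : PreservesFiniteLimits (globalSections X) :=
  have : PreservesLimitsOfSize.{0, 0} (globalSections X) :=
    constLimAdj.rightAdjoint_preservesLimits
  ⟨fun _ => inferInstance⟩

instance (f : C(X, Y)) : PreservesFiniteLimits (directImage f) where
  preservesFiniteLimits _ _ _ :=
    { preservesLimit := fun {D} => preservesLimit_of_evaluation _ _ fun y =>
        inferInstanceAs (PreservesLimit D (sections (preimageU f (Specialization.ofEquiv y)))) }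

variable (f : C(X, Y)) (x : X)

/-- The fiber over `y` of the map `C_x ⟶ C_{f(x)}`. -/
abbrev closureFiber (y : (closure {f x} : Set Y)) : Set (closure {x} : Set X) :=
  restrictClosure f x ⁻¹' {y}

variable (y : (closure {f x} : Set Y))

/-- The inclusion of a fiber of `C_x ⟶ C_{f(x)}` into the corresponding fiber of `f`. -/
def closureFiberIncl : C(closureFiber f x y, f ⁻¹' {y.1}) where
  toFun z := ⟨z.1.1, congrArg Subtype.val z.2⟩
  continuous_toFun := by fun_prop

/-- The inclusion of a fiber of `C_x ⟶ C_{f(x)}` into the corresponding fiber of `f`, whose left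
adjoint is defined on the closure of `x`. -/
def closureFiberReflection : PartialReflection (Specialization (closureFiber f x y))
    (Specialization (f ⁻¹' {y.1})) where
  incl := (Specialization.map (closureFiberIncl f x y)).monotone.functor
  dom s := Specialization.toEquiv (Specialization.ofEquiv s).1 ≤ Specialization.toEquiv x
  refl s h := Specialization.toEquiv
    ⟨⟨(Specialization.ofEquiv s).1, specializes_iff_mem_closure.1 h⟩,
      Subtype.ext (Specialization.ofEquiv s).2⟩
  dom_of_hom g h := le_trans (specialization_val_le.2 g.le) h
  reflMap {s t} g _ _ := homOfLE (specialization_val_le.1 (specialization_val_le.1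
    (specialization_val_le (S := f ⁻¹' {y.1}) (s := s) (t := t).2 g.le)))
  dom_incl z := specializes_iff_mem_closure.2 (Specialization.ofEquiv z).1.2
  unit _ _ := 𝟙 _
  counit _ _ := 𝟙 _

/-- The restriction of a skyscraper to a fiber of `f` is the extension of constant data. -/
def restrictSkyscraperIso (M : AbData PUnit.{u + 1}) :
    (restrict (f ⁻¹' {y.1})).obj ((skyscraper x).obj M) ≅
      (closureFiberReflection f x y).extend.obj
        ((constData (closureFiber f x y)).obj (pointValue.obj M)) :=
  NatIso.ofComponents
    (fun s =>
      { hom := (closureFiberReflection f x y).extendLift _ s fun h => skyscraperπ x M h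
        inv := (pointReflection x).extendLift M _ fun h =>
          (closureFiberReflection f x y).extendπ _ s h
        hom_inv_id := skyscraper_hom_ext fun h => by
          refine (Category.assoc _ _ _).trans ?_
          refine (congrArg (_ ≫ ·) ((pointReflection x).extendLift_π M _ _ h)).trans ?_
          exact ((closureFiberReflection f x y).extendLift_π _ s _ h).trans
            (Category.id_comp _).symm
        inv_hom_id := PartialReflection.extend_hom_ext fun h => by
          refine (Category.assoc _ _ _).trans ?_
          refine (congrArg (_ ≫ ·) ((closureFiberReflection f x y).extendLift_π _ s _ h)).trans ?_
          exact ((pointReflection x).extendLift_π M _ _ h).trans (Category.id_comp _).symm })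
    fun {s t} g => PartialReflection.extend_hom_ext fun h => by
      refine (Category.assoc _ _ _).trans ?_
      refine (congrArg (_ ≫ ·) ((closureFiberReflection f x y).extendLift_π _ t _ h)).trans ?_
      refine (skyscraper_map_π x M _ h).trans ?_
      refine Eq.trans ?_ (Category.assoc _ _ _).symm
      refine Eq.trans ?_ (congrArg (_ ≫ ·)
        ((closureFiberReflection f x y).extend_obj_map_π _ g h).symm)
      refine Eq.trans ?_ (congrArg (_ ≫ ·) (Category.comp_id _).symm)
      exact ((closureFiberReflection f x y).extendLift_π
        ((constData (closureFiber f x y)).obj (pointValue.obj M)) s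
        (fun h => skyscraperπ x M h) _).symm

/-- The cohomology of the restriction of a skyscraper to a fiber of `f` is the cohomology of the
fiber of `C_x ⟶ C_{f(x)}`. -/
def cohomologyRestrictSkyscraperIso (M : AbData PUnit.{u + 1}) (i : ℕ) :
    (cohomology (f ⁻¹' {y.1}) i).obj ((restrict (f ⁻¹' {y.1})).obj ((skyscraper x).obj M)) ≅
      (cohomology (closureFiber f x y) i).obj
        ((constData (closureFiber f x y)).obj (pointValue.obj M)) :=
  (cohomology _ i).mapIso (restrictSkyscraperIso f x y M) ≪≫
    rightDerivedObjIso (closureFiberReflection f x y).extend (fun _ _ => inferInstance)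
      (globalSections _) (globalSections _) (closureFiberReflection f x y).extendCompLim i _

/-- Both morphisms are the identity of `M` at each point of the fiber lying in `C_x`; elsewhere the
target is zero. -/
theorem toSectionsSkyscraper_restrictSkyscraperIso (M : AbData PUnit.{u + 1}) :
    toSectionsSkyscraper (f ⁻¹' {y.1}) x M ≫
      (globalSections _).map (restrictSkyscraperIso f x y M).hom =
    constLimAdj.unit.app (pointValue.obj M) ≫ lim.map
      ((closureFiberReflection f x y).adj.unit.app ((Functor.const _).obj (pointValue.obj M))) := by
  refine limit.hom_ext fun s => PartialReflection.extend_hom_ext fun h => ?_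
  have e₁ : (globalSections _).map (restrictSkyscraperIso f x y M).hom ≫ limit.π _ s =
      limit.π _ s ≫ (restrictSkyscraperIso f x y M).hom.app s := limMap_π _ _
  have e₂ : lim.map ((closureFiberReflection f x y).adj.unit.app
      ((Functor.const _).obj (pointValue.obj M))) ≫ limit.π _ s =
      limit.π _ s ≫ ((closureFiberReflection f x y).adj.unit.app
        ((Functor.const _).obj (pointValue.obj M))).app s := limMap_π _ _
  have e₃ : (restrictSkyscraperIso f x y M).hom.app s ≫
      (closureFiberReflection f x y).extendπ _ s h = skyscraperπ x M h :=
    (closureFiberReflection f x y).extendLift_π _ s _ h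
  have e₄ := (closureFiberReflection f x y).adj_unit_app_app_π
    ((Functor.const _).obj (pointValue.obj M)) s h
  have e₅ : constLimAdj.unit.app (pointValue.obj M) ≫ limit.π _ s = 𝟙 _ := limit.lift_π _ _
  have e₆ : toSectionsSkyscraper (f ⁻¹' {y.1}) x M ≫ limit.π _ s = skyscraperLift x M _ (𝟙 _) :=
    limit.lift_π _ _
  have l₁ : (toSectionsSkyscraper (f ⁻¹' {y.1}) x M ≫
      (globalSections _).map (restrictSkyscraperIso f x y M).hom) ≫ limit.π _ s =
      skyscraperLift x M _ (𝟙 _) ≫ (restrictSkyscraperIso f x y M).hom.app s :=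
    (Category.assoc _ _ _).trans ((congrArg (_ ≫ ·) e₁).trans
      ((Category.assoc _ _ _).symm.trans (congrArg (· ≫ _) e₆)))
  have l₂ : (constLimAdj.unit.app (pointValue.obj M) ≫
      lim.map ((closureFiberReflection f x y).adj.unit.app
        ((Functor.const _).obj (pointValue.obj M)))) ≫ limit.π _ s =
      𝟙 _ ≫ ((closureFiberReflection f x y).adj.unit.app
        ((Functor.const _).obj (pointValue.obj M))).app s :=
    (Category.assoc _ _ _).trans ((congrArg (_ ≫ ·) e₂).trans
      ((Category.assoc _ _ _).symm.trans (congrArg (· ≫ _) e₅)))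
  refine ((congrArg (· ≫ _) l₁).trans ((Category.assoc _ _ _).trans
    ((congrArg (_ ≫ ·) e₃).trans (skyscraperLift_π x M (𝟙 _) h)))).trans ?_
  exact ((congrArg (· ≫ _) l₂).trans ((Category.assoc _ _ _).trans
    ((Category.id_comp _).trans e₄))).symm

/-- The sections of a skyscraper on a fiber of `f`. -/
theorem isIso_toSectionsSkyscraper_fiber_iff (M : AbData PUnit.{u + 1}) :
    IsIso (toSectionsSkyscraper (f ⁻¹' {y.1}) x M) ↔
      IsIso (toCohomologyZero (closureFiber f x y) (pointValue.obj M)) := by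
  have h := toSectionsSkyscraper_restrictSkyscraperIso f x y M
  have h' := (closureFiberReflection f x y).unit_extendCompLim (pointValue.obj M)
  rw [← reassoc_of% h] at h'
  unfold toCohomologyZero
  rw [isIso_comp_right_iff]
  have h'' : IsIso ((globalSections (f ⁻¹' {y.1})).map (restrictSkyscraperIso f x y M).hom ≫
      (closureFiberReflection f x y).extendCompLim.hom.app
        ((Functor.const _).obj (pointValue.obj M))) := inferInstance
  rw [← isIso_comp_right_iff _ ((globalSections (f ⁻¹' {y.1})).map
    (restrictSkyscraperIso f x y M).hom ≫ (closureFiberReflection f x y).extendCompLim.hom.app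
        ((Functor.const _).obj (pointValue.obj M)))]
  exact iff_of_eq (congrArg IsIso h')

theorem mem_preimageU_iff {f : C(X, Y)} {x : X} {y : Y} :
    x ∈ preimageU f y ↔ y ∈ closure {f x} := by
  rw [preimageU, Set.mem_preimage, mem_nhdsKer_singleton, specializes_iff_mem_closure]

/-- As `x ∈ f⁻¹(U_y)`, the source is `M`, and base change becomes the canonical map from `M` to the
sections on the fiber. -/
theorem isIso_sectionsBaseChange_skyscraper_iff (M : AbData PUnit.{u + 1}) :
    IsIso ((sectionsBaseChange f y.1).app ((skyscraper x).obj M)) ↔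
      IsIso (toCohomologyZero (closureFiber f x y) (pointValue.obj M)) := by
  rw [← isIso_toSectionsSkyscraper_fiber_iff]
  have := isIso_toSectionsSkyscraper (mem_preimageU_iff.2 y.2) M
  have h := toSectionsSkyscraper_res (fiber_subset_preimageU f y.1) x M
  exact (isIso_comp_left_iff (toSectionsSkyscraper (preimageU f y.1) x M) _).symm.trans
    (iff_of_eq (congrArg IsIso h))

/-- A point `s ∈ S ∩ C_x` would give `y ∈ C_{f(s)} ⊆ C_{f(x)}`. -/
theorem isZero_restrict_skyscraper_of_notMem {f : C(X, Y)} {x : X} {y : Y} {S : Set X}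
    (hS : S ⊆ preimageU f y) (hy : y ∉ closure {f x}) (M : AbData PUnit.{u + 1}) :
    IsZero ((restrict S).obj ((skyscraper x).obj M)) := by
  refine isZero_restrict_skyscraper M fun s hs hsx => hy ?_
  rw [← mem_preimageU_iff] at hy ⊢
  have h₁ : f s ⤳ y := mem_nhdsKer_singleton.1 (hS hs)
  have h₂ : x ⤳ s := hsx
  exact mem_nhdsKer_singleton.2 ((h₂.map f.continuous).trans h₁)

/-- The stalks of the direct image of a skyscraper. -/
def pointValueIso : pointValue ≅ (skyscraper x ⋙ directImage f) ⋙ stalk y.1 :=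
  NatIso.ofComponents (fun M =>
      have := isIso_toSectionsSkyscraper (mem_preimageU_iff.2 y.2) M
      let e : pointValue.obj M ≅ (sections (preimageU f y.1)).obj ((skyscraper x).obj M) :=
        asIso (toSectionsSkyscraper (preimageU f y.1) x M)
      e)
    fun φ => toSectionsSkyscraper_naturality _ x φ

/-- The higher direct images of a skyscraper vanish at the closure of `f(x)`. -/
theorem isZero_stalk_higherDirectImage_skyscraper (M : AbData PUnit.{u + 1}) (i : ℕ) :
    IsZero ((stalk y.1).obj ((higherDirectImage f (i + 1)).obj ((skyscraper x).obj M))) := by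
  let I := injectiveResolution M
  let K := skyscraper x ⋙ directImage f
  -- The skyscraper functor is exact and preserves injectives, so the resolution may be taken on the
  -- point. There the stalk at `y` of the direct image is just the value, and a resolution has no
  -- homology in positive degrees.
  have e₁ : (higherDirectImage f (i + 1)).obj ((skyscraper x).obj M) ≅
      (K.rightDerived (i + 1)).obj M :=
    rightDerivedObjIso (skyscraper x) (fun _ _ => inferInstance) (directImage f) K (Iso.refl _)
      (i + 1) M
  have e₂ := mapHomologyObjIso (stalk y.1)
    ((K.mapHomologicalComplex (ComplexShape.up ℕ)).obj I.cocomplex) (i + 1)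
  have e₃ := (HomologicalComplex.homologyFunctor _ _ (i + 1)).mapIso
    ((NatIso.mapHomologicalComplex (pointValueIso f x y) (ComplexShape.up ℕ)).app I.cocomplex)
  have e₄ := mapHomologyObjIso pointValue.{u} I.cocomplex (i + 1)
  have h : IsZero (I.cocomplex.homology (i + 1)) :=
    (I.cocomplex.exactAt_iff_isZero_homology _).1 (I.cocomplex_exactAt_succ i)
  have h₁ := ((pointValue.map_isZero h).of_iso e₄.symm).of_iso e₃.symm
  have h₂ := IsZero.of_iso (Y := (((K ⋙ stalk y.1).mapHomologicalComplex
    (ComplexShape.up ℕ)).obj I.cocomplex).homology (i + 1)) h₁ e₂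
  exact h₂.of_iso ((stalk y.1).mapIso (e₁ ≪≫ rightDerivedIsoHomology K I (i + 1)))

end Fiber

/-! ### Cohomologically proper maps and base change -/

section BaseChange

/-- A natural transformation between additive functors which is an isomorphism at some objects is
an isomorphism at their sums and at the direct summands of these sums. -/
theorem isIso_app_of_sum_comp_eq_id {A D : Type*} [Category* A] [Category* D] [Preadditive A]
    [Preadditive D] {P Q : A ⥤ D} [P.Additive] [Q.Additive] (θ : P ⟶ Q) {ι : Type*} [Fintype ι]
    {B : A} {C : ι → A} (a : ∀ j, B ⟶ C j) (b : ∀ j, C j ⟶ B) (hab : ∑ j, a j ≫ b j = 𝟙 B)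
    (h : ∀ j, IsIso (θ.app (C j))) : IsIso (θ.app B) := by
  refine ⟨∑ j, Q.map (a j) ≫ inv (θ.app (C j)) ≫ P.map (b j), ?_, ?_⟩
  · rw [Preadditive.comp_sum, ← P.map_id, ← hab, P.map_sum]
    refine Finset.sum_congr rfl fun j _ => ?_
    rw [← NatTrans.naturality_assoc, IsIso.hom_inv_id_assoc, P.map_comp]
  · rw [Preadditive.sum_comp, ← Q.map_id, ← hab, Q.map_sum]
    refine Finset.sum_congr rfl fun j _ => ?_
    rw [Category.assoc, Category.assoc, NatTrans.naturality, IsIso.inv_hom_id_assoc, Q.map_comp]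

theorem extAcyclic_of_isZero {A : Type*} [Category* A] [Abelian A] [HasExt A] {K B : A}
    (h : IsZero B) : ExtAcyclic K B :=
  ExtAcyclic.of_sum_comp_eq_id (ι := Empty) (C := fun _ => B) (fun _ => 0) (fun _ => 0)
    (h.eq_of_src _ _) fun x => x.elim

variable {X Y : Type u} [TopologicalSpace X] [TopologicalSpace Y]

/-- On the empty space `H⁰(X, ℤ) = 0`, which is not `ℤ`. -/
theorem nonempty_of_isHomologicallyTrivial (h : IsHomologicallyTrivial X) : Nonempty X := by
  by_contra hX
  rw [not_nonempty_iff] at hX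
  let G : AddCommGrpCat.{u} := AddCommGrpCat.of (ULift.{u} ℤ)
  have h₁ : IsZero ((constData X).obj G) :=
    Functor.isZero _ fun x => (hX.false (Specialization.ofEquiv x)).elim
  have := (h G).1
  have h₂ : IsZero G :=
    (((globalSections X).map_isZero h₁).of_iso
      (asIso ((globalSections X).toRightDerivedZero.app ((constData X).obj G))).symm).of_iso
        (asIso (toCohomologyZero X G))
  have := AddCommGrpCat.subsingleton_of_isZero h₂
  exact absurd (Subsingleton.elim (α := ULift.{u} ℤ) ⟨0⟩ ⟨1⟩) (by simp)

/-- Nonempty fibers mean `C_{f(x)} ⊆ f(C_x)`, so the image of a closed set `K` is the finite union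
of the `C_{f(x)}` for `x ∈ K`. -/
theorem isClosedMap_of_isHomologicallyTrivial [Finite X] (f : C(X, Y))
    (h : ∀ (x : X) (y : (closure {f x} : Set Y)),
      IsHomologicallyTrivial (closureFiber f x y)) : IsClosedMap f := by
  intro K hK
  have e : f '' K = ⋃ x ∈ K, closure {f x} := by
    refine Set.Subset.antisymm ?_ (Set.iUnion₂_subset fun x hx y hy => ?_)
    · rintro _ ⟨x, hx, rfl⟩
      exact Set.mem_biUnion hx (subset_closure rfl)
    · obtain ⟨⟨z, hz⟩⟩ := nonempty_of_isHomologicallyTrivial (h x ⟨y, hy⟩)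
      exact ⟨z.1, hK.closure_subset_iff.2 (Set.singleton_subset_iff.2 hx) z.2,
        congrArg Subtype.val hz⟩
  rw [e]
  exact (Set.toFinite K).isClosed_biUnion fun x _ => isClosed_closure

/-! ### Base change when the fibers are homologically trivial -/

section

variable {f : C(X, Y)}
  (h : ∀ (x : X) (y : (closure {f x} : Set Y)), IsHomologicallyTrivial (closureFiber f x y))

include h

theorem extAcyclic_restrict_skyscraper (x : X) (y : Y) [HasExt (AbData (f ⁻¹' {y}))]
    (M : AbData PUnit.{u + 1}) :
    ExtAcyclic (corepresenting (Functor.const (Specialization (f ⁻¹' {y}))))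
      ((restrict (f ⁻¹' {y})).obj ((skyscraper x).obj M)) := by
  by_cases hy : y ∈ closure {f x}
  · exact extAcyclic_of_isZero_rightDerived constLimAdj fun i =>
      ((h x ⟨y, hy⟩ (pointValue.obj M)).2 (i + 1) i.succ_pos).of_iso
        (cohomologyRestrictSkyscraperIso f x ⟨y, hy⟩ M (i + 1))
  · exact extAcyclic_of_isZero
      (isZero_restrict_skyscraper_of_notMem (fiber_subset_preimageU f y) hy M)

theorem isIso_sectionsBaseChange_skyscraper (x : X) (y : Y) (M : AbData PUnit.{u + 1}) :
    IsIso ((sectionsBaseChange f y).app ((skyscraper x).obj M)) := by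
  by_cases hy : y ∈ closure {f x}
  · exact (isIso_sectionsBaseChange_skyscraper_iff f x ⟨y, hy⟩ M).2
      (h x ⟨y, hy⟩ (pointValue.obj M)).1
  · have h₁ : IsZero ((directImage f ⋙ stalk y).obj ((skyscraper x).obj M)) :=
      (globalSections _).map_isZero
        (isZero_restrict_skyscraper_of_notMem (S := preimageU f y) subset_rfl hy M)
    have h₂ : IsZero ((restrict (f ⁻¹' {y}) ⋙ globalSections (f ⁻¹' {y})).obj
        ((skyscraper x).obj M)) :=
      (globalSections _).map_isZero
        (isZero_restrict_skyscraper_of_notMem (fiber_subset_preimageU f y) hy M)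
    exact ⟨0, h₁.eq_of_src _ _, h₂.eq_of_src _ _⟩

theorem isIso_baseChange [Finite X] (F : AbData X) (y : Y) (i : ℕ) :
    IsIso (baseChange f y i F) := by
  have : HasExt.{u + 1} (AbData (f ⁻¹' {y})) := HasExt.standard _
  refine isIso_derivedComparison (directImage f) (stalk y) (restrict (f ⁻¹' {y})) constLimAdj
    (sectionsBaseChange f y) (fun I _ => ?_) (fun I _ => ?_) i F
  -- Both conditions pass to finite sums and direct summands, so it suffices to check them on
  -- skyscrapers.
  all_goals obtain ⟨n, x, b, hb⟩ := exists_sum_toSkyscraper_comp_eq_id I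
  · exact isIso_app_of_sum_comp_eq_id _ _ b hb
      fun j => isIso_sectionsBaseChange_skyscraper h _ y _
  · refine ExtAcyclic.of_sum_comp_eq_id
      (fun j => (restrict (f ⁻¹' {y})).map (toSkyscraper (x j) I))
      (fun j => (restrict (f ⁻¹' {y})).map (b j)) ?_
      fun j => extAcyclic_restrict_skyscraper h (x j) y _
    simp only [← Functor.map_comp, ← Functor.map_sum, hb]
    exact (restrict (f ⁻¹' {y})).map_id I

end

/-- Base change is applied to the skyscraper at `x` with value `G`: degree zero gives the canonical
isomorphism, and in positive degrees the source vanishes. -/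
theorem isHomologicallyTrivial_of_isIso_baseChange {f : C(X, Y)}
    (h : ∀ (F : AbData X) (y : Y) (i : ℕ), IsIso (baseChange f y i F)) (x : X)
    (y : (closure {f x} : Set Y)) : IsHomologicallyTrivial (closureFiber f x y) := fun G => by
  let M : AbData PUnit.{u + 1} := (constData PUnit.{u + 1}).obj G
  refine ⟨?_, fun i hi => ?_⟩
  · have : IsIso (derivedComparison (directImage f) (stalk y.1) (restrict (f ⁻¹' {y.1}))
        (globalSections (f ⁻¹' {y.1})) (sectionsBaseChange f y.1) 0 ((skyscraper x).obj M)) :=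
      h _ _ _
    exact (isIso_sectionsBaseChange_skyscraper_iff f x y M).1
      (isIso_app_of_isIso_derivedComparison _ _ _ _ _ _)
  · obtain ⟨i, rfl⟩ := Nat.exists_eq_succ_of_ne_zero hi.ne'
    have := h ((skyscraper x).obj M) y.1 (i + 1)
    exact ((isZero_stalk_higherDirectImage_skyscraper f x y M i).of_iso
      (asIso (baseChange f y.1 (i + 1) ((skyscraper x).obj M))).symm).of_iso
        (cohomologyRestrictSkyscraperIso f x y M (i + 1)).symm

end BaseChange

end FiniteSpace

end

theorem mainTheorem1 {X Y : Type u} [TopologicalSpace X] [TopologicalSpace Y] [Finite X] [Finite Y]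
    (f : C(X, Y)) :
    FiniteSpace.IsCProper f ↔
      ∀ (F : FiniteSpace.AbData X) (y : Y) (i : ℕ), IsIso (FiniteSpace.baseChange f y i F) :=
  ⟨fun h => FiniteSpace.isIso_baseChange h.2, fun h =>
    have h' := FiniteSpace.isHomologicallyTrivial_of_isIso_baseChange h
    ⟨FiniteSpace.isClosedMap_of_isHomologicallyTrivial f h', h'⟩⟩
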